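/- Let $P,X,Y,E$ be finite-dimensional Euclidean spaces, $Z:=P\times X$, $g\colon Z\to Y$, $C\subset Y$ closed, $\Gamma(p):=\{x\in X\mid g(p,x)\in C\}$, and $\bar z=(\bar p,\bar x)$ with $g(\bar z)\in C$. **Notation.** Dual spaces are not identified with primal ones, $\langle\cdot,\cdot\rangle$ is the duality pairing, and $A^*$ is the adjoint of a linear map $A$. For a set $\Omega$, $T_\Omega(w)$ is the Bouligand (contingent) tangent cone, and $N_\Omega(w)$ is the limiting normal cone, i.e. the set of limits of regular (Fréchet) normals at points of $\Omega$ tending to $w$, with $N_\Omega(w)=\emptyset$ if $w\notin\Omega$. For a cone $S$, $S^*:=\{w^*\mid\langle w^*,w\rangle\le0\ \forall w\in S\}$. Further, $\mathcal K_\Omega(w,w^*):=T_\Omega(w)\cap\{w^*\}^\perp$, $\pi_{X^*}(p^*,x^*):=x^*$, $\Psi(p,x):=N_{\Gamma(p)}(x)$, and $D\Psi(\bar z,\bar x^*)(v):=\{u^*\mid(v,u^*)\in T_{\mathrm{gph}\,\Psi}(\bar z,\bar x^*)\}$. **Assumptions.** (i) $g$ is $C^2$-smooth around $\bar z$. (ii)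 $C$ is $C^2$-reducible at $g(\bar z)$ to a closed convex cone $K\subset E$: there are an open neighborhood $V$ of $g(\bar z)$ and a $C^2$ mapping $h\colon V\to E$ with $h(g(\bar z))=0$, $\nabla h(g(\bar z))$ surjective, and $C\cap V=\{y\in V\mid h(y)\in K\}$. (iii) $\bar x^*\in N_{\Gamma(\bar p)}(\bar x)$. (iv) (Robinson stability) There are $\kappa\ge0$ and neighborhoods $W$ of $\bar p$ and $U$ of $\bar x$ with $\mathrm{dist}(x;\Gamma(p))\le\kappa\,\mathrm{dist}(g(p,x);C)$ for all $(p,x)\in W\times U$, where $\mathrm{dist}(x;\emptyset)=\infty$. **Further objects.** Let $G:=h\circ g$ (defined near $\bar z$) and $$\mathcal P:=\{q\in P\mid\nabla_pG(\bar z)q\in\mathrm{rge}\,\nabla_xG(\bar z)+(K\cap(-K))\}.$$ The modified graphical derivative $\widetilde D\Psi(\bar z,\bar x^*)(q,u)$ is the set of all $u^*$ for which there are $t_k\downarrow0$ and $(q_k,u_k,u_k^*)\to(q,u,u^*)$ with $\bar x^*+t_ku_k^*\in\Psi(\bar p+t_kq_k,\bar x+t_ku_k)$ and $\limsup_{k\to\infty}\mathrm{dist}(q_k-q;\mathcal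 P)/t_k<\infty$. For $\lambda\in N_C(g(\bar z))$ let $\mu_\lambda:=(\nabla h(g(\bar z))^*)^{-1}\lambda$ be the unique $\mu\in E^*$ with $\nabla h(g(\bar z))^*\mu=\lambda$, and define $\mathcal H_\lambda\colon Z\to X^*$ by $$\mathcal H_\lambda v:=\nabla_xg(\bar z)^*\,\nabla^2\langle\mu_\lambda,h(\cdot)\rangle(g(\bar z))\,\nabla g(\bar z)v.$$ Finally, let $\Lambda(\bar z,z^*):=\{\lambda\in N_C(g(\bar z))\mid\nabla g(\bar z)^*\lambda=z^*\}$, and let $\Lambda(\bar z,z^*;v)$ be the set of maximizers over $\lambda\in\Lambda(\bar z,z^*)$ of $$\langle\lambda,\nabla^2g(\bar z)(v,v)\rangle+\nabla^2\langle\mu_\lambda,h(\cdot)\rangle(g(\bar z))(\nabla g(\bar z)v,\nabla g(\bar z)v).$$ **Claim.** For all $v=(q,u)\in P\times X$ we have $$\widetilde D\Psi(\bar z,\bar x^*)(v)\subset\mathcal S(v)\subset D\Psi(\bar z,\bar x^*)(v)\subset\mathcal U(v).$$ Here $\mathcal S(v)$ is the set of all elements $\big(\nabla(\nabla_xg(\cdot)^*\hat\lambda)(\bar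 z)+\mathcal H_{\hat\lambda}\big)v+w^*_{x^*}$ such that there is $z^*\in N_{T_{\mathrm{gph}\,\Gamma}(\bar z)}(v)$ with $\pi_{X^*}(z^*)=\bar x^*$, $\hat\lambda\in\Lambda(\bar z,z^*;v)$, and $w_k^*\in\mathcal K_{\mathrm{gph}\,\Gamma}(\bar z,z^*)^*$ ($k\in\mathbb N$) with $\pi_{X^*}(w_k^*)\to w^*_{x^*}$ and $\langle w_k^*,v\rangle\to0$; and $$\mathcal U(v):=\Big\{\big(\nabla(\nabla_xg(\cdot)^*\hat\lambda)(\bar z)+\mathcal H_{\hat\lambda}\big)v+w^*\ \Big|\ \hat\lambda\in N_{T_C(g(\bar z))}(\nabla g(\bar z)v),\ \nabla_xg(\bar z)^*\hat\lambda=\bar x^*,\ w^*\in\mathcal K_{\Gamma(\bar p)}(\bar x,\bar x^*)^*\Big\}.$$ -/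

import Mathlib

open Filter Topology Set
open scoped NNReal ENNReal Pointwise

noncomputable section

namespace PCS

section Cones

variable {Z U : Type*} [NormedAddCommGroup Z] [NormedSpace ℝ Z]
  [NormedAddCommGroup U] [NormedSpace ℝ U]

/-- The Bouligand-Severi tangent (contingent) cone to `Ω` at `z`. -/
def tangentCone (Ω : Set Z) (z : Z) : Set Z :=
  {w | ∃ (t : ℕ → ℝ) (wk : ℕ → Z), (∀ k, 0 < t k) ∧ Tendsto t atTop (𝓝 0) ∧
    Tendsto wk atTop (𝓝 w) ∧ ∀ k, z + t k • wk k ∈ Ω}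

/-- The tangent cone above is Mathlib's positive tangent cone. -/
theorem tangentCone_eq_posTangentConeAt (Ω : Set Z) (z : Z) :
    tangentCone Ω z = posTangentConeAt Ω z := by
  ext w
  constructor
  · rintro ⟨t, wk, ht, ht0, hw, hm⟩
    refine mem_tangentConeAt_of_seq atTop (fun k => (⟨(t k)⁻¹, (inv_pos.2 (ht k)).le⟩ : ℝ≥0))
      (fun k => t k • wk k) ?_ (Eventually.of_forall hm) ?_
    · simpa using ht0.smul hw
    · refine hw.congr fun k => ?_
      change wk k = (t k)⁻¹ • (t k • wk k)
      rw [smul_smul, inv_mul_cancel₀ (ht k).ne', one_smul]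
  · intro hw
    have key : ∀ n : ℕ, ∃ (t : ℝ) (y : Z), 0 < t ∧ t < 1 / (n + 1) ∧ ‖y - w‖ < 1 / (n + 1) ∧
        z + t • y ∈ Ω := by
      intro n
      have hn : (0:ℝ) < 1 / (n + 1) := by positivity
      obtain ⟨α, l, hl, c, d, hd, hds, hcd⟩ := exists_fun_of_mem_tangentConeAt hw
      by_cases hw0 : w = 0
      · subst hw0
        have h1 : ∀ᶠ a in l, ‖d a‖ < (1 / (n + 1)) * (1 / (2 * (n + 1))) := by
          have := (tendsto_zero_iff_norm_tendsto_zero.1 hd)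
          exact this.eventually_lt_const (by positivity)
        obtain ⟨a, ha, hb⟩ := (h1.and hds).exists
        have hp : (0:ℝ) < 1 / (2 * (n + 1)) := by positivity
        refine ⟨1 / (2 * (n + 1)), (1 / (2 * ((n:ℝ) + 1)))⁻¹ • d a, hp, ?_, ?_, ?_⟩
        · gcongr; linarith [(Nat.cast_nonneg n : (0:ℝ) ≤ n)]
        · rw [sub_zero, norm_smul, norm_inv, Real.norm_of_nonneg hp.le, inv_mul_lt_iff₀ hp]
          linarith
        · rw [smul_smul, mul_inv_cancel₀ hp.ne', one_smul]; exact hb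
      · have hpos : 0 < ‖w‖ := norm_pos_iff.2 hw0
        have h1 : ∀ᶠ a in l, ‖c a • d a - w‖ < min (1 / ((n:ℝ) + 1)) (‖w‖ / 2) :=
          (tendsto_iff_norm_sub_tendsto_zero.1 hcd).eventually_lt_const (lt_min hn (half_pos hpos))
        have h2 : ∀ᶠ a in l, ‖d a‖ < (1 / ((n:ℝ) + 1)) * (‖w‖ / 2) :=
          (tendsto_zero_iff_norm_tendsto_zero.1 hd).eventually_lt_const (by positivity)
        obtain ⟨a, ⟨ha, hb⟩, hc⟩ := ((h1.and h2).and hds).exists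
        have ha1 := lt_of_lt_of_le ha (min_le_left _ _)
        have ha2 := lt_of_lt_of_le ha (min_le_right _ _)
        have hlow : ‖w‖ / 2 < ‖c a • d a‖ := by
          have := norm_sub_norm_le w (c a • d a)
          rw [norm_sub_rev] at this
          linarith
        have hcs : c a • d a = (c a : ℝ) • d a := rfl
        have hcn : ‖c a • d a‖ = (c a : ℝ) * ‖d a‖ := by
          rw [hcs, norm_smul]; exact congrArg (· * ‖d a‖) (Real.norm_of_nonneg (c a).2)
        have hcpos : 0 < (c a : ℝ) := by
          rcases (c a).2.eq_or_lt with h | h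
          · have : (c a : ℝ) = 0 := h.symm
            rw [hcn, this, zero_mul] at hlow
            linarith
          · exact h
        refine ⟨(c a : ℝ)⁻¹, c a • d a, inv_pos.2 hcpos, ?_, ha1, ?_⟩
        · rw [inv_lt_comm₀ hcpos hn]
          by_contra hle
          push Not at hle
          have : (c a : ℝ) * ‖d a‖ ≤ (1 / ((n:ℝ) + 1))⁻¹ * ((1 / (n + 1)) * (‖w‖ / 2)) := by
            gcongr
          rw [← mul_assoc, inv_mul_cancel₀ hn.ne', one_mul] at this
          linarith
        · rw [hcs, smul_smul, inv_mul_cancel₀ hcpos.ne', one_smul]; exact hc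
    choose t y h1 h2 h3 h4 using key
    refine ⟨t, y, h1, ?_, ?_, h4⟩
    · exact squeeze_zero (fun n => (h1 n).le) (fun n => (h2 n).le)
        tendsto_one_div_add_atTop_nhds_zero_nat
    · rw [tendsto_iff_norm_sub_tendsto_zero]
      exact squeeze_zero (fun n => norm_nonneg _) (fun n => (h3 n).le)
        tendsto_one_div_add_atTop_nhds_zero_nat

/-- The Fréchet (regular) normal cone to `Ω` at `z`; it is empty if `z ∉ Ω`. -/
def regularNormalCone (Ω : Set Z) (z : Z) : Set (StrongDual ℝ Z) :=
  {zs | z ∈ Ω ∧ ∀ ε : ℝ, 0 < ε → ∀ᶠ y in 𝓝[Ω] z, zs (y - z) ≤ ε * ‖y - z‖}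

/-- The limiting (Mordukhovich) normal cone to `Ω` at `z`; it is empty if `z ∉ Ω`. -/
def normalCone (Ω : Set Z) (z : Z) : Set (StrongDual ℝ Z) :=
  {zs | z ∈ Ω ∧ ∃ (zk : ℕ → Z) (zsk : ℕ → StrongDual ℝ Z), (∀ k, zk k ∈ Ω) ∧
    Tendsto zk atTop (𝓝 z) ∧ (∀ k, zsk k ∈ regularNormalCone Ω (zk k)) ∧
    Tendsto zsk atTop (𝓝 zs)}

/-- The dual (polar) cone `S^* = {z^* | ⟨z^*, w⟩ ≤ 0 for all w ∈ S}`. -/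
def polarCone (S : Set Z) : Set (StrongDual ℝ Z) :=
  {zs | ∀ w ∈ S, zs w ≤ 0}

/-- The critical cone `𝒦_Ω(z, z^*) = T_Ω(z) ∩ {z^*}^⊥`. -/
def criticalCone (Ω : Set Z) (z : Z) (zs : StrongDual ℝ Z) : Set Z :=
  tangentCone Ω z ∩ {w | zs w = 0}

/-- The graph of a set-valued mapping. -/
def graph {A B : Type*} (F : A → Set B) : Set (A × B) :=
  {ab | ab.2 ∈ F ab.1}

/-- The graphical derivative `DΨ(z, u)(w)` of a set-valued mapping at a point of its graph. -/
def graphicalDeriv (Ψ : Z → Set U) (z : Z) (u : U) (w : Z) : Set U :=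
  {v | (w, v) ∈ tangentCone (graph Ψ) (z, u)}

/-- `(A^*)⁻¹ lam`: a functional `μ` with `A^* μ = μ ∘ A = lam`, whenever there is one.
It is unique if `A` is surjective. -/
def adjointInv (A : Z →L[ℝ] U) (lam : StrongDual ℝ Z) : StrongDual ℝ U :=
  Function.invFun (fun μ : StrongDual ℝ U => μ.comp A) lam

theorem adjointInv_comp (A : Z →L[ℝ] U) (hA : Function.Surjective A) (μ : StrongDual ℝ U) :
    adjointInv A (μ.comp A) = μ := by
  refine Function.leftInverse_invFun ?_ μ
  intro μ₁ μ₂ h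
  ext e
  obtain ⟨y, rfl⟩ := hA e
  exact DFunLike.congr_fun h y

end Cones

section Reduction

variable {Y E : Type*} [NormedAddCommGroup Y] [NormedSpace ℝ Y]
  [NormedAddCommGroup E] [NormedSpace ℝ E]

/-- `C` is `C²`-reducible at `y` to the closed convex cone `K`, the reduction being given by the
mapping `h` on the open neighborhood `V` of `y`. The values of `h` outside `V` play no role. -/
structure IsC2Reduction (C : Set Y) (y : Y) (K : ProperCone ℝ E) (V : Set Y) (h : Y → E) :
    Prop where
  isClosed : IsClosed C
  mem : y ∈ C
  isOpen_nhd : IsOpen V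
  mem_nhd : y ∈ V
  contDiffOn : ContDiffOn ℝ 2 h V
  map_eq_zero : h y = 0
  surjective : Function.Surjective (fderiv ℝ h y)
  mem_iff : ∀ y' ∈ V, y' ∈ C ↔ h y' ∈ K

end Reduction

section System

variable {P X Y E : Type*}
  [NormedAddCommGroup P] [NormedSpace ℝ P] [NormedAddCommGroup X] [NormedSpace ℝ X]
  [NormedAddCommGroup Y] [NormedSpace ℝ Y] [NormedAddCommGroup E] [NormedSpace ℝ E]

/-- The partial derivative `∇_x g(z)`. -/
def derivX (g : P × X → Y) (z : P × X) : X →L[ℝ] Y :=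
  fderiv ℝ (fun x => g (z.1, x)) z.2

/-- The partial derivative `∇_p g(z)`. -/
def derivP (g : P × X → Y) (z : P × X) : P →L[ℝ] Y :=
  fderiv ℝ (fun p => g (p, z.2)) z.1

/-- The canonical projection `π_{X^*} : (P × X)^* = P^* × X^* → X^*`. -/
def projX (zs : StrongDual ℝ (P × X)) : StrongDual ℝ X :=
  zs.comp (ContinuousLinearMap.inr ℝ P X)

/-- The solution map `Γ(p) = {x | g(p, x) ∈ C}`. -/
def solMap (g : P × X → Y) (C : Set Y) (p : P) : Set X :=
  {x | g (p, x) ∈ C}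

/-- The normal cone mapping `Ψ(p, x) = N_{Γ(p)}(x)` (empty if `x ∉ Γ(p)`). -/
def normalMap (g : P × X → Y) (C : Set Y) (z : P × X) : Set (StrongDual ℝ X) :=
  normalCone (solMap g C z.1) z.2

/-- Robinson stability of `g(p, x) ∈ C` at `z = (p̄, x̄)`. The distance is the extended one, so
that the distance to the empty set is `∞`. -/
def RobinsonStable (g : P × X → Y) (C : Set Y) (z : P × X) : Prop :=
  ∃ κ : ℝ≥0, ∃ W ∈ 𝓝 z.1, ∃ U ∈ 𝓝 z.2, ∀ p ∈ W, ∀ x ∈ U,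
    Metric.infEDist x (solMap g C p) ≤ κ * Metric.infEDist (g (p, x)) C

/-- The characteristic subspace
`𝒫 = {q | ∇_p G(z) q ∈ rge ∇_x G(z) + lin K}` with `G = h ∘ g` and `lin K = K ∩ (-K)`. -/
def charSubspace (g : P × X → Y) (z : P × X) (K : ProperCone ℝ E) (h : Y → E) : Set P :=
  {q | derivP (h ∘ g) z q ∈ range (derivX (h ∘ g) z) + ((K : Set E) ∩ -(K : Set E))}

/-- The modified graphical derivative `D̃Ψ(p̄, x̄, x̄^*)(q, u)` of the normal cone mapping. -/
def modGraphicalDeriv (g : P × X → Y) (C : Set Y) (z : P × X) (xs : StrongDual ℝ X)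
    (K : ProperCone ℝ E) (h : Y → E) (v : P × X) : Set (StrongDual ℝ X) :=
  {us | ∃ (t : ℕ → ℝ) (q : ℕ → P) (u : ℕ → X) (usk : ℕ → StrongDual ℝ X),
    (∀ k, 0 < t k) ∧ Tendsto t atTop (𝓝 0) ∧
    Tendsto q atTop (𝓝 v.1) ∧ Tendsto u atTop (𝓝 v.2) ∧ Tendsto usk atTop (𝓝 us) ∧
    (∀ k, xs + t k • usk k ∈ normalMap g C (z.1 + t k • q k, z.2 + t k • u k)) ∧
    ∃ M : ℝ, ∀ᶠ k in atTop,
      Metric.infDist (q k - v.1) (charSubspace g z K h) / t k ≤ M}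

/-- The Hessian `∇²⟨(∇h(g(z))^*)⁻¹ lam, h(·)⟩(g(z))`. -/
def curvatureHessian (g : P × X → Y) (z : P × X) (h : Y → E) (lam : StrongDual ℝ Y) :
    Y →L[ℝ] StrongDual ℝ Y :=
  fderiv ℝ (fderiv ℝ (fun y => adjointInv (fderiv ℝ h (g z)) lam (h y))) (g z)

/-- The mapping `𝓗_lam v = ∇_x g(z)^* ∇²⟨(∇h(g(z))^*)⁻¹ lam, h(·)⟩(g(z)) ∇g(z) v`. -/
def curvatureMap (g : P × X → Y) (z : P × X) (h : Y → E) (lam : StrongDual ℝ Y) (v : P × X) :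
    StrongDual ℝ X :=
  (curvatureHessian g z h lam (fderiv ℝ g z v)).comp (derivX g z)

/-- `(∇(∇_x g(·)^* lam)(z) + 𝓗_lam) v`. -/
def secondOrderTerm (g : P × X → Y) (z : P × X) (h : Y → E) (lam : StrongDual ℝ Y)
    (v : P × X) : StrongDual ℝ X :=
  fderiv ℝ (fun z' => lam.comp (derivX g z')) z v + curvatureMap g z h lam v

/-- The multiplier set `Λ(z, z^*) = {lam ∈ N_C(g(z)) | ∇g(z)^* lam = z^*}`. -/
def multipliers (g : P × X → Y) (C : Set Y) (z : P × X) (zs : StrongDual ℝ (P × X)) :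
    Set (StrongDual ℝ Y) :=
  {lam | lam ∈ normalCone C (g z) ∧ lam.comp (fderiv ℝ g z) = zs}

/-- The directional multiplier set `Λ(z, z^*; v)`: the maximizers over `Λ(z, z^*)` of
`⟨lam, ∇²g(z)(v, v)⟩ + ∇²⟨(∇h(g(z))^*)⁻¹ lam, h(·)⟩(g(z))(∇g(z) v, ∇g(z) v)`. -/
def dirMultipliers (g : P × X → Y) (C : Set Y) (z : P × X) (h : Y → E)
    (zs : StrongDual ℝ (P × X)) (v : P × X) : Set (StrongDual ℝ Y) :=
  {lam | lam ∈ multipliers g C z zs ∧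
    IsMaxOn (fun l : StrongDual ℝ Y => l (fderiv ℝ (fderiv ℝ g) z v v) +
      curvatureHessian g z h l (fderiv ℝ g z v) (fderiv ℝ g z v)) (multipliers g C z zs) lam}

/-- The intermediate set: all `(∇(∇_x g(·)^* lam)(z) + 𝓗_lam) v + w_x^*` such that there is
`z^* ∈ N_{T_{gph Γ}(z)}(v)` with `π_{X^*} z^* = x^*`, `lam ∈ Λ(z, z^*; v)`, and a sequence
`w_k^* ∈ 𝒦_{gph Γ}(z, z^*)^*` with `π_{X^*} w_k^* → w_x^*` and `⟨w_k^*, v⟩ → 0`. -/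
def limitSet (g : P × X → Y) (C : Set Y) (z : P × X) (xs : StrongDual ℝ X) (h : Y → E)
    (v : P × X) : Set (StrongDual ℝ X) :=
  {us | ∃ zs ∈ normalCone (tangentCone (graph (solMap g C)) z) v, projX zs = xs ∧
    ∃ lam ∈ dirMultipliers g C z h zs v, ∃ wx : StrongDual ℝ X,
      (∃ wk : ℕ → StrongDual ℝ (P × X),
        (∀ k, wk k ∈ polarCone (criticalCone (graph (solMap g C)) z zs)) ∧
        Tendsto (fun k => projX (wk k)) atTop (𝓝 wx) ∧
        Tendsto (fun k => wk k v) atTop (𝓝 0)) ∧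
      us = secondOrderTerm g z h lam v + wx}

/-- The upper estimate: all elements of `(∇(∇_x g(·)^* lam)(z) + 𝓗_lam) v + 𝒦_{Γ(p̄)}(x̄, x^*)^*`
with `lam ∈ N_{T_C(g(z))}(∇g(z) v)` and `∇_x g(z)^* lam = x^*`. -/
def upperSet (g : P × X → Y) (C : Set Y) (z : P × X) (xs : StrongDual ℝ X) (h : Y → E)
    (v : P × X) : Set (StrongDual ℝ X) :=
  {us | ∃ lam ∈ normalCone (tangentCone C (g z)) (fderiv ℝ g z v), lam.comp (derivX g z) = xs ∧
    ∃ w ∈ polarCone (criticalCone (solMap g C z.1) z.2 xs),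
      us = secondOrderTerm g z h lam v + w}

end System

end PCS

end

noncomputable section

namespace PCS

/-! ### Joint limits of operators and arguments -/

section Limits

variable {ι A B D : Type*} [NormedAddCommGroup A] [NormedSpace ℝ A]
  [NormedAddCommGroup B] [NormedSpace ℝ B] [NormedAddCommGroup D] [NormedSpace ℝ D]
  {l : Filter ι}

/-! The reduction turns the problem into one about `G = h ∘ g`: near the reference point, gph Γ is
`{G ∈ K}` with `G(z) = 0`, and Robinson stability passes to `dist(x, Γ(p)) ≤ κ dist(G(p, x), K)`.
Hence the tangent cone of gph Γ is `{w | ∇G(z) w ∈ K}`, normals to Γ(p) are `∇ₓG^* m` with `m ∈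
K^*`, `m(G) = 0`, `‖m‖` at most κ times the norm of the normal, and `N_C(g(z)) = ∇h^* K^*`. Write `A
= ∇G(z)` and `b = ∇²G(z)(v, v)`.

Outer estimates. Along a sequence defining a graphical derivative the multipliers `m_k` are bounded,
so they converge to some μ along a subsequence. Put `W_k = t_k⁻¹ (m_k - μ) ∘ A`. Subtracting the
limit relation shows that the projections of `W_k` to `X^*` converge to the first-order remainder,
and `W_k` is nonpositive on critical directions. This already gives the upper estimate. Under the
condition on `𝒫`, `⟨W_k, w_k - v⟩ → 0`; a second-order expansion of `G`, paired with `m_k`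
(complementary) and with μ (only nonpositive), then squeezes `⟨W_k, v⟩` to zero and forces μ to
maximize `⟨·, b⟩` (`lower_estimate_of_seq`).

Inner estimate. Maximality of μ yields, by conic duality up to closure, approximate dual solutions
`w` with `A w + b` near `K` and `μ(A w)` near `-μ(b)`. The curve `z + t v + (t²/2) w` is then
feasible up to a small multiple of `t²`; Robinson stability repairs it in `x` alone. A perturbed
multiplier `(1 - tα) μ + tν` is almost complementary there, so its pullback almost maximizes a
linear functional over Γ(p). A quadratic variational argument (`exists_regularNormal_near`) replaces
it by a true regular normal nearby, with errors of order `θ t`, where θ is arbitrary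
(`eventually_exists_near`, `lower_inclusion`). -/

theorem tendsto_clm_apply {f : ι → A →L[ℝ] B} {f₀ : A →L[ℝ] B} {x : ι → A} {x₀ : A}
    (hf : Tendsto f l (𝓝 f₀)) (hx : Tendsto x l (𝓝 x₀)) :
    Tendsto (fun i => f i (x i)) l (𝓝 (f₀ x₀)) :=
  (isBoundedBilinearMap_apply.continuous.tendsto (f₀, x₀)).comp (hf.prodMk_nhds hx)

theorem tendsto_clm_comp {f : ι → B →L[ℝ] D} {f₀ : B →L[ℝ] D} {g : ι → A →L[ℝ] B}
    {g₀ : A →L[ℝ] B} (hf : Tendsto f l (𝓝 f₀)) (hg : Tendsto g l (𝓝 g₀)) :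
    Tendsto (fun i => (f i).comp (g i)) l (𝓝 (f₀.comp g₀)) :=
  (isBoundedBilinearMap_comp.continuous.tendsto (f₀, g₀)).comp (hf.prodMk_nhds hg)

end Limits

/-! ### Separation of convex cones and reflexivity -/

section Separation

variable {A : Type*} [NormedAddCommGroup A] [NormedSpace ℝ A]

/-- A point outside the closure of a convex cone is strictly separated from it. -/
theorem exists_separating_of_notMem_closure (D : PointedCone ℝ A) {x : A}
    (hx : x ∉ closure (D : Set A)) :
    ∃ f : StrongDual ℝ A, (∀ d ∈ D, f d ≤ 0) ∧ 0 < f x := by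
  let C : ProperCone ℝ A := ⟨D.closure, isClosed_closure⟩
  obtain ⟨f, hf, hfx⟩ := C.hyperplane_separation_point (x₀ := x) hx
  refine ⟨-f, fun d hd => ?_, by simpa using hfx⟩
  have := hf d (subset_closure hd)
  simpa using this

/-- Finite-dimensional spaces are reflexive. -/
theorem exists_eval_eq [FiniteDimensional ℝ A] (f : StrongDual ℝ (StrongDual ℝ A)) :
    ∃ w : A, ∀ φ : StrongDual ℝ A, f φ = φ w := by
  let e : StrongDual ℝ A ≃ₗ[ℝ] Module.Dual ℝ A := LinearMap.toContinuousLinearMap.symm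
  obtain ⟨w, hw⟩ := (Module.evalEquiv ℝ A).surjective (f.toLinearMap.comp e.symm.toLinearMap)
  refine ⟨w, fun φ => ?_⟩
  have := LinearMap.congr_fun hw (e φ)
  exact this.symm

theorem mem_of_polarCone_le (K : ProperCone ℝ A) {y : A}
    (hy : ∀ μ ∈ polarCone (K : Set A), μ y ≤ 0) : y ∈ K := by
  by_contra h
  obtain ⟨f, hf, hfy⟩ := exists_separating_of_notMem_closure (K : PointedCone ℝ A) (x := y)
    (by rw [show ((K : PointedCone ℝ A) : Set A) = (K : Set A) from rfl, K.isClosed.closure_eq]; exact h)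
  exact absurd (hy f hf) (not_le.2 hfy)

end Separation

/-! ### Tangents, normals, and a variational principle -/

section Tangent

variable {A : Type*} [NormedAddCommGroup A] [NormedSpace ℝ A]

theorem mem_tangentCone_of_forall {Ω : Set A} {a w : A}
    (hw : ∀ δ : ℝ, 0 < δ → ∃ t : ℝ, 0 < t ∧ t < δ ∧ ∃ w' : A, ‖w' - w‖ < δ ∧ a + t • w' ∈ Ω) :
    w ∈ tangentCone Ω a := by
  have hn : ∀ n : ℕ, (0:ℝ) < 1 / (n + 1) := fun n => by positivity
  choose t h1 h2 y h3 h4 using fun n : ℕ => hw _ (hn n)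
  refine ⟨t, y, h1, ?_, ?_, h4⟩
  · exact squeeze_zero (fun n => (h1 n).le) (fun n => (h2 n).le)
      tendsto_one_div_add_atTop_nhds_zero_nat
  · rw [tendsto_iff_norm_sub_tendsto_zero]
    exact squeeze_zero (fun n => norm_nonneg _) (fun n => (h3 n).le)
      tendsto_one_div_add_atTop_nhds_zero_nat

theorem regularNormalCone_subset_normalCone (Ω : Set A) (a : A) :
    regularNormalCone Ω a ⊆ normalCone Ω a := fun xs hxs =>
  ⟨hxs.1, fun _ => a, fun _ => xs, fun _ => hxs.1, tendsto_const_nhds, fun _ => hxs,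
    tendsto_const_nhds⟩

theorem mem_normalCone_of_forall_le {Ω : Set A} {a : A} {xs : StrongDual ℝ A} (ha : a ∈ Ω)
    (h : ∀ y ∈ Ω, xs (y - a) ≤ 0) : xs ∈ normalCone Ω a := by
  refine regularNormalCone_subset_normalCone _ _ ⟨ha, fun ε hε => ?_⟩
  filter_upwards [self_mem_nhdsWithin] with y hy
  exact (h y hy).trans (by positivity)

/-- Regular normals to a convex set are normals in the sense of convex analysis. -/
theorem le_zero_of_mem_regularNormalCone {Ω : Set A} (hΩ : Convex ℝ Ω) {a : A}
    {xs : StrongDual ℝ A} (h : xs ∈ regularNormalCone Ω a) {y : A} (hy : y ∈ Ω) :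
    xs (y - a) ≤ 0 := by
  obtain ⟨ha, h⟩ := h
  refine le_of_forall_pos_le_add fun ε hε => ?_
  rw [zero_add]
  have hpos : 0 < ‖y - a‖ + 1 := by positivity
  have h1 := h (ε / (‖y - a‖ + 1)) (by positivity)
  have hlim : Tendsto (fun t : ℝ => a + t • (y - a)) (𝓝[>] 0) (𝓝[Ω] a) := by
    refine tendsto_nhdsWithin_iff.2 ⟨?_, ?_⟩
    · have : Continuous fun t : ℝ => a + t • (y - a) := by fun_prop
      simpa using (this.tendsto 0).mono_left nhdsWithin_le_nhds
    · filter_upwards [Ioo_mem_nhdsGT (zero_lt_one (α := ℝ))] with t ht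
      exact hΩ.add_smul_sub_mem ha hy ⟨ht.1.le, ht.2.le⟩
  obtain ⟨t, ht, ht0⟩ := ((hlim.eventually h1).and self_mem_nhdsWithin).exists
  have ht0 : 0 < t := ht0
  rw [add_sub_cancel_left, map_smul, norm_smul, Real.norm_of_nonneg ht0.le, smul_eq_mul] at ht
  have : xs (y - a) ≤ ε / (‖y - a‖ + 1) * ‖y - a‖ := by
    refine le_of_mul_le_mul_left ?_ ht0
    linarith
  refine this.trans ?_
  rw [div_mul_eq_mul_div, div_le_iff₀ hpos]
  nlinarith [norm_nonneg (y - a)]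

theorem le_zero_of_mem_normalCone {Ω : Set A} (hΩ : Convex ℝ Ω) {a : A}
    {xs : StrongDual ℝ A} (h : xs ∈ normalCone Ω a) {y : A} (hy : y ∈ Ω) :
    xs (y - a) ≤ 0 := by
  obtain ⟨-, zk, xk, -, hzk, hreg, hxk⟩ := h
  have : Tendsto (fun k => xk k (y - zk k)) atTop (𝓝 (xs (y - a))) :=
    tendsto_clm_apply hxk (tendsto_const_nhds.sub hzk)
  exact le_of_tendsto' this fun k => le_zero_of_mem_regularNormalCone hΩ (hreg k) hy

/-- Near-maximizers of a functional over `M` up to a quadratic term are close to points with a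
close regular normal. -/
theorem exists_regularNormal_near {X : Type*} [NormedAddCommGroup X] [InnerProductSpace ℝ X]
    [FiniteDimensional ℝ X] {M : Set X} {a : X} (ha : a ∈ M) {xs : StrongDual ℝ X}
    {c r θ : ℝ} (hc : 0 < c) (hθ : 0 ≤ θ) (hr : θ < r)
    (hcl : IsClosed (M ∩ Metric.closedBall a r))
    (hM : ∀ x ∈ M ∩ Metric.closedBall a r, xs (x - a) ≤ c * θ ^ 2 + c * ‖x - a‖ ^ 2) :
    ∃ x' ∈ M, ‖x' - a‖ ≤ θ ∧ ∃ xs' ∈ regularNormalCone M x', ‖xs' - xs‖ ≤ 4 * c * θ := by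
  have hcomp : IsCompact (M ∩ Metric.closedBall a r) :=
    (isCompact_closedBall a r).of_isClosed_subset hcl inter_subset_right
  have ha' : a ∈ M ∩ Metric.closedBall a r :=
    ⟨ha, Metric.mem_closedBall_self (hθ.trans hr.le)⟩
  -- The penalty weight is twice the constant `c` of `hM`, so comparison with `a` still leaves `c
  -- ‖x' - a‖² ≤ c θ²`.
  obtain ⟨x', hx', hmin⟩ := hcomp.exists_isMinOn ⟨a, ha'⟩
    (f := fun x => 2 * c * ‖x - a‖ ^ 2 - xs (x - a)) (by fun_prop)
  have h0 : 2 * c * ‖x' - a‖ ^ 2 - xs (x' - a) ≤ 0 := by simpa using hmin ha'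
  have hclose : ‖x' - a‖ ≤ θ := by
    have := hM x' hx'
    have : c * ‖x' - a‖ ^ 2 ≤ c * θ ^ 2 := by linarith
    exact le_of_sq_le_sq (le_of_mul_le_mul_left this hc) hθ
  -- The normal is `xs` minus the gradient of the penalty at `x'`. Since `θ < r`, the minimizer is
  -- interior to the ball, so it is a local minimizer over all of `M`; the radius `ε / (2c)` used
  -- below absorbs the quadratic remainder.
  refine ⟨x', hx'.1, hclose, xs - (4 * c) • innerSL ℝ (x' - a), ⟨hx'.1, fun ε hε => ?_⟩, ?_⟩
  · have hball : Metric.ball a r ∈ 𝓝 x' :=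
      Metric.isOpen_ball.mem_nhds (by rw [Metric.mem_ball, dist_eq_norm]; linarith)
    have hsmall : Metric.ball x' (ε / (2 * c)) ∈ 𝓝 x' := Metric.ball_mem_nhds _ (by positivity)
    filter_upwards [self_mem_nhdsWithin, nhdsWithin_le_nhds hball, nhdsWithin_le_nhds hsmall]
      with x hx hxb hxs
    have h1 : 2 * c * ‖x' - a‖ ^ 2 - xs (x' - a) ≤ 2 * c * ‖x - a‖ ^ 2 - xs (x - a) :=
      hmin ⟨hx, Metric.ball_subset_closedBall hxb⟩
    have h2 : ‖x - a‖ ^ 2 = ‖x' - a‖ ^ 2 + 2 * inner ℝ (x' - a) (x - x') + ‖x - x'‖ ^ 2 := by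
      rw [← norm_add_sq_real]; congr 2; abel
    have h3 : xs (x - x') = xs (x - a) - xs (x' - a) := by rw [← map_sub]; congr 1; abel
    rw [Metric.mem_ball, dist_eq_norm, lt_div_iff₀ (by positivity)] at hxs
    simp only [sub_apply, smul_apply, innerSL_apply_apply, smul_eq_mul, h3]
    rw [h2] at h1
    nlinarith [norm_nonneg (x - x')]
  · rw [sub_sub_cancel_left, norm_neg, norm_smul, innerSL_apply_norm, Real.norm_of_nonneg (by positivity)]
    gcongr

end Tangent

/-! ### Multipliers for constraint systems, with norm bounds -/

section Multipliers

variable {A E : Type*} [NormedAddCommGroup A] [NormedSpace ℝ A]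
  [NormedAddCommGroup E] [InnerProductSpace ℝ E]

/-- Projecting onto a closed convex cone: the distance to the tangent cone of `K` at `y₀`, bounded
below by `m`, is attained by a unit normal. -/
theorem exists_normal_of_le_norm_sub [CompleteSpace E] (K : ProperCone ℝ E) {y₀ : E}
    (hy₀ : y₀ ∈ K) {y : E} {R m : ℝ} (hR : 0 ≤ R) (hm : 0 < m)
    (h : ∀ e ∈ K, ∀ s : ℝ, 0 < s → m ≤ R * ‖y - s • (e - y₀)‖) :
    ∃ μ : StrongDual ℝ E, ‖μ‖ ≤ R ∧ (∀ e ∈ K, μ (e - y₀) ≤ 0) ∧ m ≤ μ y := by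
  set T₀ : Set E := {τ | ∃ s : ℝ, 0 < s ∧ ∃ e ∈ K, τ = s • (e - y₀)} with hT₀
  have hadd : ∀ τ ∈ T₀, ∀ τ' ∈ T₀, τ + τ' ∈ T₀ := by
    rintro _ ⟨s, hs, e, he, rfl⟩ _ ⟨s', hs', e', he', rfl⟩
    refine ⟨s + s', by positivity, (s + s')⁻¹ • (s • e + s' • e'),
      K.smul_mem (K.add_mem (K.smul_mem he hs.le) (K.smul_mem he' hs'.le)) (by positivity), ?_⟩
    have hne : s + s' ≠ 0 := by positivity
    rw [smul_sub (s + s'), smul_smul (s + s'), mul_inv_cancel₀ hne, one_smul]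
    module
  have hsmul : ∀ c : ℝ, 0 < c → ∀ τ ∈ T₀, c • τ ∈ T₀ := by
    rintro c hc _ ⟨s, hs, e, he, rfl⟩
    exact ⟨c * s, by positivity, e, he, by rw [mul_smul]⟩
  have hne : T₀.Nonempty := ⟨_, 1, one_pos, y₀, hy₀, rfl⟩
  have hconv : Convex ℝ T₀ := by
    intro τ hτ τ' hτ' a b ha hb hab
    rcases ha.eq_or_lt with rfl | ha
    · rw [zero_add] at hab; subst hab; simpa using hτ'
    rcases hb.eq_or_lt with rfl | hb
    · rw [add_zero] at hab; subst hab; simpa using hτ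
    exact hadd _ (hsmul a ha _ hτ) _ (hsmul b hb _ hτ')
  obtain ⟨π, hπ, hmin⟩ := exists_norm_eq_iInf_of_complete_convex hne.closure
    isClosed_closure.isComplete hconv.closure y
  rw [norm_eq_iInf_iff_real_inner_le_zero hconv.closure hπ] at hmin
  have hmπ : m ≤ R * ‖y - π‖ := by
    have hcl : IsClosed {τ : E | m ≤ R * ‖y - τ‖} :=
      isClosed_le continuous_const (by fun_prop)
    refine closure_minimal ?_ hcl hπ
    rintro _ ⟨s, hs, e, he, rfl⟩
    exact h e he s hs
  have hpos : 0 < ‖y - π‖ := by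
    by_contra hcon
    have : ‖y - π‖ = 0 := le_antisymm (not_lt.1 hcon) (norm_nonneg _)
    rw [this, mul_zero] at hmπ
    linarith
  -- Both `2π` and `π/2` lie in the closed cone, so the variational inequality of the projection
  -- holds with either sign.
  have hπ0 : inner ℝ (y - π) π = 0 := by
    have hc : ∀ c : ℝ, 0 < c → inner ℝ (y - π) (c • π - π) ≤ 0 := fun c hc =>
      hmin _ (map_mem_closure (continuous_const_smul c) hπ (hsmul c hc))
    have h1 := hc 2 (by norm_num)
    have h2 := hc (1 / 2) (by norm_num)
    rw [inner_sub_right, inner_smul_right] at h1 h2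
    linarith
  -- The projection residual scaled to norm `R`; by orthogonality to `π` its value at `y` is `R ‖y -
  -- π‖`.
  refine ⟨(R / ‖y - π‖) • innerSL ℝ (y - π), ?_, fun e he => ?_, ?_⟩
  · rw [norm_smul, innerSL_apply_norm, Real.norm_of_nonneg (by positivity), div_mul_cancel₀ _ hpos.ne']
  · have h1 := hmin (π + (e - y₀)) (map_mem_closure (f := fun τ => τ + (e - y₀)) (by fun_prop) hπ
      fun τ hτ => hadd τ hτ _ ⟨1, one_pos, e, he, (one_smul _ _).symm⟩)
    rw [add_sub_cancel_left] at h1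
    simp only [smul_apply, innerSL_apply_apply, smul_eq_mul]
    exact mul_nonpos_of_nonneg_of_nonpos (by positivity) h1
  · have : inner ℝ (y - π) y = ‖y - π‖ ^ 2 := by
      rw [← real_inner_self_eq_norm_sq]
      conv_rhs => rw [inner_sub_right, hπ0, sub_zero]
    simp only [smul_apply, innerSL_apply_apply, smul_eq_mul, this]
    refine hmπ.trans (le_of_eq ?_)
    field_simp

/-- Bounded multipliers by duality. -/
theorem exists_multiplier_of_forall_le [FiniteDimensional ℝ A] [FiniteDimensional ℝ E]
    (K : ProperCone ℝ E) {y₀ : E} (hy₀ : y₀ ∈ K) (F' : A →L[ℝ] E) {xs : StrongDual ℝ A} {R : ℝ}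
    (hR : 0 ≤ R) (h : ∀ u, ∀ e ∈ K, xs u ≤ R * ‖F' u - (e - y₀)‖) :
    ∃ μ : StrongDual ℝ E, ‖μ‖ ≤ R ∧ (∀ e ∈ K, μ (e - y₀) ≤ 0) ∧ μ.comp F' = xs := by
  have : FiniteDimensional ℝ (StrongDual ℝ E) := inferInstance
  have hproper : ProperSpace (StrongDual ℝ E) := FiniteDimensional.proper ℝ _
  set S : Set (StrongDual ℝ E) := Metric.closedBall 0 R ∩ {μ | ∀ e ∈ K, μ (e - y₀) ≤ 0} with hS
  have hScl : IsClosed {μ : StrongDual ℝ E | ∀ e ∈ K, μ (e - y₀) ≤ 0} := by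
    simp only [ofPred_forall]
    refine isClosed_iInter fun e => isClosed_iInter fun _ => ?_
    exact isClosed_le (by fun_prop) continuous_const
  have hScomp : IsCompact S := (isCompact_closedBall 0 R).inter_right hScl
  have hSconv : Convex ℝ S := by
    refine (convex_closedBall _ _).inter fun μ hμ ν hν a b ha hb _ e he => ?_
    have h1 := mul_nonpos_of_nonneg_of_nonpos ha (hμ e he)
    have h2 := mul_nonpos_of_nonneg_of_nonpos hb (hν e he)
    simp only [add_apply, smul_apply, smul_eq_mul]
    linarith
  let Φ : StrongDual ℝ E →L[ℝ] StrongDual ℝ A := (ContinuousLinearMap.compL ℝ A E ℝ).flip F'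
  by_contra hcon
  have hx : xs ∉ Φ '' S := by
    rintro ⟨μ, ⟨h1, h2⟩, h3⟩
    exact hcon ⟨μ, by simpa using h1, h2, h3⟩
  -- If no multiplier exists, `xs` is strictly separated from the compact convex image of `S`.
  -- Reflexivity makes the separating functional a vector `u`, and the normal constructed at `F' u`
  -- violates the separation.
  obtain ⟨f, b, hfb, hbx⟩ := geometric_hahn_banach_closed_point
    (hSconv.linear_image Φ.toLinearMap) (hScomp.image Φ.continuous).isClosed hx
  obtain ⟨u, hu⟩ := exists_eval_eq f
  rw [hu] at hbx
  have hb : 0 < b := by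
    have := hfb (Φ 0) ⟨0, ⟨by simpa using hR, fun e _ => by simp⟩, rfl⟩
    simpa using this
  obtain ⟨μ, hμR, hμ, hμu⟩ := exists_normal_of_le_norm_sub K hy₀ (y := F' u) hR (hb.trans hbx)
    (fun e he s hs => by
      have := h (s⁻¹ • u) e he
      rw [map_smul, map_smul, smul_eq_mul, inv_mul_le_iff₀ hs] at this
      refine this.trans (le_of_eq ?_)
      have h2 : s⁻¹ • F' u - (e - y₀) = s⁻¹ • (F' u - s • (e - y₀)) := by
        rw [smul_sub, smul_smul, inv_mul_cancel₀ hs.ne', one_smul]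
      rw [h2, norm_smul, norm_inv, Real.norm_of_nonneg hs.le]
      field_simp)
  have := hfb (Φ μ) ⟨μ, ⟨by simpa using hμR, hμ⟩, rfl⟩
  rw [hu] at this
  have h3 : (Φ μ) u = μ (F' u) := rfl
  linarith

/-- Step from `a` to `a + t u` and correct back into `M` with target `F a + t (e - F a)`, which is
in `K` by convexity. The correction costs at most `κ t ‖F' u - (e - F a)‖ + o(t)`. Apply the regular
normal inequality to the corrected point, divide by `t`, and let `t` and then `ε` tend to zero. -/
theorem le_of_mem_regularNormalCone {M : Set A} {F : A → E} {F' : A →L[ℝ] E} {a : A} {κ : ℝ}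
    (K : ProperCone ℝ E) (hF : HasFDerivAt F F' a) (hFa : F a ∈ K)
    (hrob : ∀ᶠ x in 𝓝 a, ∀ e ∈ K, ∃ x' ∈ M, ‖x' - x‖ ≤ κ * ‖F x - e‖)
    {xs : StrongDual ℝ A} (hxs : xs ∈ regularNormalCone M a) (u : A) {e : E} (he : e ∈ K) :
    xs u ≤ κ * ‖xs‖ * ‖F' u - (e - F a)‖ := by
  have ht : Tendsto (fun t : ℝ => a + t • u) (𝓝[>] 0) (𝓝 a) := by
    have : Continuous fun t : ℝ => a + t • u := by fun_prop
    simpa using (this.tendsto 0).mono_left nhdsWithin_le_nhds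
  have hev : ∀ᶠ t : ℝ in 𝓝[>] 0, ∃ x' ∈ M,
      ‖x' - (a + t • u)‖ ≤ κ * ‖F (a + t • u) - (F a + t • (e - F a))‖ := by
    filter_upwards [ht.eventually hrob, Ioo_mem_nhdsGT (zero_lt_one (α := ℝ))] with t h1 h2
    exact h1 _ (K.convex.add_smul_sub_mem hFa he ⟨h2.1.le, h2.2.le⟩)
  set d : ℝ → ℝ := fun t => ‖t⁻¹ • (F (a + t • u) - F a) - (e - F a)‖ with hd
  have hdlim : Tendsto d (𝓝[>] 0) (𝓝 ‖F' u - (e - F a)‖) := by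
    have : HasDerivAt (fun t : ℝ => F (a + t • u)) (F' u) 0 := by
      have h1 : HasDerivAt (fun t : ℝ => a + t • u) u 0 := by
        simpa using ((hasDerivAt_id (0:ℝ)).smul_const u).const_add a
      have h2 : HasFDerivAt F F' (a + (0:ℝ) • u) := by simpa using hF
      exact h2.comp_hasDerivAt _ h1
    have h3 := this.tendsto_slope_zero_right
    simp only [zero_add, zero_smul, add_zero] at h3
    exact (h3.sub_const _).norm
  have hdd : ∀ t : ℝ, 0 < t → ‖F (a + t • u) - (F a + t • (e - F a))‖ = t * d t := by
    intro t ht0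
    have : F (a + t • u) - (F a + t • (e - F a)) =
        t • (t⁻¹ • (F (a + t • u) - F a) - (e - F a)) := by
      rw [smul_sub t (t⁻¹ • _), smul_smul t t⁻¹, mul_inv_cancel₀ ht0.ne', one_smul]; abel
    rw [this, norm_smul, Real.norm_of_nonneg ht0.le]
  set D := ‖F' u - (e - F a)‖ with hD
  have key : ∀ ε : ℝ, 0 < ε → xs u ≤ ε * (‖u‖ + κ * D) + κ * ‖xs‖ * D := by
    intro ε hε
    have hlim : Tendsto (fun t => ε * (‖u‖ + κ * d t) + κ * ‖xs‖ * d t) (𝓝[>] 0)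
        (𝓝 (ε * (‖u‖ + κ * D) + κ * ‖xs‖ * D)) :=
      (((hdlim.const_mul κ).const_add _).const_mul ε).add (hdlim.const_mul _)
    refine ge_of_tendsto hlim ?_
    obtain ⟨r, hr, hball⟩ := Metric.mem_nhdsWithin_iff.1 (hxs.2 ε hε)
    have hsmall : ∀ᶠ t : ℝ in 𝓝[>] 0, t * (‖u‖ + κ * d t) < r := by
      have h1 : Tendsto (fun t : ℝ => t * (‖u‖ + κ * d t)) (𝓝[>] 0) (𝓝 (0 * (‖u‖ + κ * D))) :=
        (tendsto_id.mono_left nhdsWithin_le_nhds).mul ((hdlim.const_mul κ).const_add _)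
      rw [zero_mul] at h1
      exact h1.eventually_lt_const hr
    filter_upwards [hev, hsmall, self_mem_nhdsWithin] with t ⟨x', hx'M, hx'⟩ hs ht0
    have ht0 : 0 < t := ht0
    rw [hdd t ht0] at hx'
    have hb : ‖x' - a‖ ≤ t * (‖u‖ + κ * d t) := by
      have h1 : x' - a = (x' - (a + t • u)) + t • u := by abel
      rw [h1]
      refine (norm_add_le _ _).trans ?_
      rw [norm_smul, Real.norm_of_nonneg ht0.le]
      linarith
    have h2 : xs (x' - a) ≤ ε * ‖x' - a‖ :=
      hball ⟨by rw [Metric.mem_ball, dist_eq_norm]; linarith, hx'M⟩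
    have h3 : t * xs u = xs (x' - a) - xs (x' - (a + t • u)) := by
      rw [← map_sub, ← smul_eq_mul, ← map_smul]; congr 1; abel
    have h4 : -xs (x' - (a + t • u)) ≤ ‖xs‖ * ‖x' - (a + t • u)‖ :=
      (neg_le_abs _).trans (xs.le_opNorm _)
    have h5 : ‖xs‖ * ‖x' - (a + t • u)‖ ≤ ‖xs‖ * (κ * (t * d t)) := by gcongr
    have h6 : ε * ‖x' - a‖ ≤ ε * (t * (‖u‖ + κ * d t)) := by gcongr
    refine le_of_mul_le_mul_left (a := t) ?_ ht0
    nlinarith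
  have hlim : Tendsto (fun ε : ℝ => ε * (‖u‖ + κ * D) + κ * ‖xs‖ * D) (𝓝[>] 0)
      (𝓝 (0 * (‖u‖ + κ * D) + κ * ‖xs‖ * D)) :=
    (((tendsto_id.mono_left nhdsWithin_le_nhds).mul_const _).add_const _)
  rw [zero_mul, zero_add] at hlim
  exact ge_of_tendsto hlim (by filter_upwards [self_mem_nhdsWithin] with ε hε using key ε hε)

/-- The multiplier rule for limiting normals to `M = {x | F x ∈ K}` under a metric subregularity
condition, with a bound for the multiplier. -/
theorem exists_multiplier_of_mem_normalCone [FiniteDimensional ℝ A] [FiniteDimensional ℝ E]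
    {M : Set A} {F : A → E} {a : A} {κ : ℝ}
    (K : ProperCone ℝ E) (hκ : 0 ≤ κ) (hF : ContDiffAt ℝ 1 F a)
    (hmem : ∀ᶠ x in 𝓝 a, x ∈ M → F x ∈ K)
    (hrob : ∀ᶠ x in 𝓝 a, ∀ e ∈ K, ∃ x' ∈ M, ‖x' - x‖ ≤ κ * ‖F x - e‖)
    {xs : StrongDual ℝ A} (hxs : xs ∈ normalCone M a) :
    ∃ μ ∈ polarCone (K : Set E), ‖μ‖ ≤ κ * ‖xs‖ ∧ μ (F a) = 0 ∧ μ.comp (fderiv ℝ F a) = xs := by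
  obtain ⟨ha, zk, xk, hzM, hz, hreg, hx⟩ := hxs
  have hproper : ProperSpace (StrongDual ℝ E) := FiniteDimensional.proper ℝ _
  have hev : ∀ᶠ k in atTop, ∃ μ : StrongDual ℝ E, ‖μ‖ ≤ κ * ‖xk k‖ ∧
      (∀ e ∈ K, μ (e - F (zk k)) ≤ 0) ∧ μ.comp (fderiv ℝ F (zk k)) = xk k := by
    filter_upwards [hz.eventually (hF.eventually (by simp)), hz.eventually hmem,
      hz.eventually hrob.eventually_nhds] with k h1 h2 h3
    have hd : HasFDerivAt F (fderiv ℝ F (zk k)) (zk k) :=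
      (h1.differentiableAt (by simp)).hasFDerivAt
    exact exists_multiplier_of_forall_le K (h2 (hzM k)) _ (by positivity)
      fun u e he => le_of_mem_regularNormalCone K hd (h2 (hzM k)) h3 (hreg k) u he
  obtain ⟨N, hN⟩ := eventually_atTop.1 hev
  -- Multipliers are available only from index `N` on, hence the shift `k + N` in the subsequence
  -- below.
  choose! m hmn hmK hmc using hN
  have hbd : Tendsto (fun k => κ * ‖xk k‖) atTop (𝓝 (κ * ‖xs‖)) := hx.norm.const_mul κ
  obtain ⟨R, hR⟩ := hbd.bddAbove_range
  obtain ⟨μ, -, φ, hφ, hμ⟩ := tendsto_subseq_of_bounded (s := Metric.closedBall (0 : StrongDual ℝ E) R)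
    Metric.isBounded_closedBall (x := fun k => m (k + N)) (fun k => by
      rw [mem_closedBall_zero_iff]
      exact (hmn _ (Nat.le_add_left _ _)).trans (hR ⟨k + N, rfl⟩))
  have hψ : Tendsto (fun k => φ k + N) atTop atTop := (tendsto_add_atTop_nat N).comp hφ.tendsto_atTop
  have hle : ∀ k, N ≤ φ k + N := fun k => Nat.le_add_left _ _
  have hFz : Tendsto (fun k => F (zk (φ k + N))) atTop (𝓝 (F a)) :=
    (hF.continuousAt.tendsto.comp hz).comp hψ
  have hKμ : ∀ e ∈ K, μ (e - F a) ≤ 0 := fun e he =>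
    le_of_tendsto' (tendsto_clm_apply hμ (tendsto_const_nhds.sub hFz)) fun k => hmK _ (hle k) e he
  have hFa : F a ∈ K := hmem.self_of_nhds ha
  -- Complementarity follows from testing the normal inequality with `0` and `2 F a`, both in the
  -- cone.
  have h0 : μ (F a) = 0 := by
    have h1 := hKμ 0 K.zero_mem
    have h2 := hKμ ((2:ℝ) • F a) (K.smul_mem hFa (by norm_num))
    rw [map_sub] at h1 h2
    rw [map_smul, smul_eq_mul] at h2
    rw [map_zero] at h1
    linarith
  refine ⟨μ, fun e he => ?_, ?_, h0, ?_⟩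
  · have := hKμ e he
    rwa [map_sub, h0, sub_zero] at this
  · exact le_of_tendsto_of_tendsto' hμ.norm (hbd.comp hψ) fun k => hmn _ (hle k)
  · have hc : ContinuousAt (fderiv ℝ F) a := (hF.fderiv_right (m := 0) (by simp)).continuousAt
    have h1 : Tendsto (fun k => (m (φ k + N)).comp (fderiv ℝ F (zk (φ k + N)))) atTop
        (𝓝 (μ.comp (fderiv ℝ F a))) :=
      tendsto_clm_comp hμ ((hc.tendsto.comp hz).comp hψ)
    refine tendsto_nhds_unique h1 ((hx.comp hψ).congr fun k => ?_)
    exact (hmc _ (hle k)).symm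

/-- Functionals `μ ∘ F'` with `μ` normal to `K` at `F a` are regular normals to `{x | F x ∈ K}`. -/
theorem comp_mem_regularNormalCone {M : Set A} {F : A → E} {F' : A →L[ℝ] E} {a : A}
    (K : ProperCone ℝ E) (hF : HasFDerivAt F F' a) (ha : a ∈ M)
    (hmem : ∀ᶠ x in 𝓝 a, x ∈ M → F x ∈ K) {μ : StrongDual ℝ E}
    (hμ : μ ∈ polarCone (K : Set E)) (hμa : μ (F a) = 0) :
    μ.comp F' ∈ regularNormalCone M a := by
  refine ⟨ha, fun ε hε => ?_⟩
  have h1 := (hasFDerivAt_iff_isLittleO.1 (μ.hasFDerivAt.comp a hF)).def hε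
  filter_upwards [nhdsWithin_le_nhds h1, nhdsWithin_le_nhds hmem, self_mem_nhdsWithin]
    with x hx hxK hxM
  have h2 : μ (F x) ≤ 0 := hμ _ (hxK hxM)
  have h3 := (neg_le_abs _).trans hx
  simp only [Function.comp_apply, hμa] at h3
  linarith

end Multipliers

/-! ### First- and second-order difference quotients -/

section Calculus

variable {A E : Type*} [NormedAddCommGroup A] [NormedSpace ℝ A]
  [NormedAddCommGroup E] [NormedSpace ℝ E] {ι : Type*} {l : Filter ι}

theorem tendsto_difference_quotient {F : A → E} {F' : A →L[ℝ] E} {z : A} (hF : HasFDerivAt F F' z)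
    {t : ι → ℝ} {w : ι → A} {v : A} (ht : ∀ᶠ i in l, 0 < t i) (ht0 : Tendsto t l (𝓝 0))
    (hw : Tendsto w l (𝓝 v)) :
    Tendsto (fun i => (t i)⁻¹ • (F (z + t i • w i) - F z)) l (𝓝 (F' v)) := by
  have h2 : Tendsto (fun i => (t i)⁻¹ • (t i • w i)) l (𝓝 v) := by
    refine hw.congr' ?_
    filter_upwards [ht] with i hi
    rw [smul_smul, inv_mul_cancel₀ hi.ne', one_smul]
  exact hF.hasFDerivWithinAt (s := univ) |>.lim (by simpa using ht0.smul hw) (by simp) h2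

theorem tendsto_add_smul {z : A} {t : ι → ℝ} {w : ι → A} {v : A} (ht0 : Tendsto t l (𝓝 0))
    (hw : Tendsto w l (𝓝 v)) : Tendsto (fun i => z + t i • w i) l (𝓝 z) := by
  simpa using (ht0.smul hw).const_add z

/-- Second-order Taylor expansion. -/
theorem isLittleO_second_order {G : A → E} {z : A} (hG : ContDiffAt ℝ 2 G z) :
    (fun y => G y - G z - fderiv ℝ G z (y - z) -
      (1 / 2 : ℝ) • fderiv ℝ (fderiv ℝ G) z (y - z) (y - z)) =o[𝓝 z]
      fun y => ‖y - z‖ ^ 2 := by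
  set B := fderiv ℝ (fderiv ℝ G) z with hB
  have hsymm : ∀ a b, B a b = B b a := hG.isSymmSndFDerivAt (by simp)
  have hdB : HasFDerivAt (fderiv ℝ G) B z :=
    ((hG.fderiv_right (m := 1) (by norm_num)).differentiableAt (by simp)).hasFDerivAt
  refine Asymptotics.isLittleO_iff.2 fun ε hε => ?_
  have h1 := (hasFDerivAt_iff_isLittleO.1 hdB).def hε
  have h2 : ∀ᶠ y in 𝓝 z, HasFDerivAt G (fderiv ℝ G y) y := by
    filter_upwards [hG.eventually (by simp)] with y hy
    exact (hy.differentiableAt (by simp)).hasFDerivAt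
  obtain ⟨r, hr, hball⟩ := Metric.eventually_nhds_iff_ball.1 (h1.and h2)
  filter_upwards [Metric.ball_mem_nhds z hr] with y hy
  let Q : A → E := fun y => G y - G z - fderiv ℝ G z (y - z) - (1 / 2 : ℝ) • B (y - z) (y - z)
  have hQ : ∀ x ∈ Metric.ball z r,
      HasFDerivAt Q (fderiv ℝ G x - fderiv ℝ G z - B (x - z)) x := by
    intro x hx
    have hs : HasFDerivAt (fun x => x - z) (ContinuousLinearMap.id ℝ A) x :=
      (hasFDerivAt_id x).sub_const z
    have hb : HasFDerivAt (fun x => B (x - z) (x - z)) ((2:ℝ) • B (x - z)) x := by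
      have := (B.hasFDerivAt.comp x hs).clm_apply hs
      refine this.congr_fderiv ?_
      ext w
      have := hsymm w (x - z)
      simp only [map_sub, sub_apply] at this
      simp [two_smul, this]
    have := (((hball x hx).2.sub_const (G z)).sub ((fderiv ℝ G z).hasFDerivAt.comp x hs)).sub
      (hb.const_smul (1 / 2 : ℝ))
    refine this.congr_fderiv ?_
    ext w
    simp
  have hyz : ‖y - z‖ < r := by rwa [← dist_eq_norm]
  have hsub : Metric.closedBall z ‖y - z‖ ⊆ Metric.ball z r := Metric.closedBall_subset_ball hyz
  have hbd : ∀ x ∈ Metric.closedBall z ‖y - z‖,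
      ‖fderiv ℝ G x - fderiv ℝ G z - B (x - z)‖ ≤ ε * ‖y - z‖ := by
    intro x hx
    refine (hball x (hsub hx)).1.trans ?_
    rw [Metric.mem_closedBall, dist_eq_norm] at hx
    gcongr
  -- The remainder `Q` vanishes at `z` and its derivative is at most `ε ‖y - z‖` on this ball, so
  -- the mean value inequality gives the quadratic bound.
  have := (convex_closedBall z ‖y - z‖).norm_image_sub_le_of_norm_hasFDerivWithin_le
    (fun x hx => (hQ x (hsub hx)).hasFDerivWithinAt) hbd
    (Metric.mem_closedBall_self (norm_nonneg _)) (y := y) (by rw [Metric.mem_closedBall, dist_eq_norm])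
  have hQz : Q z = 0 := by simp [Q]
  rw [hQz, sub_zero] at this
  rw [norm_pow, norm_norm]
  exact this.trans (le_of_eq (by ring))

theorem tendsto_second_order_quotient {G : A → E} {z : A} (hG : ContDiffAt ℝ 2 G z)
    {t : ι → ℝ} {w : ι → A} {v : A} (ht : ∀ᶠ i in l, 0 < t i) (ht0 : Tendsto t l (𝓝 0))
    (hw : Tendsto w l (𝓝 v)) :
    Tendsto (fun i => (t i ^ 2)⁻¹ • (G (z + t i • w i) - G z - t i • fderiv ℝ G z (w i))) l
      (𝓝 ((1 / 2 : ℝ) • fderiv ℝ (fderiv ℝ G) z v v)) := by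
  set B := fderiv ℝ (fderiv ℝ G) z with hB
  have h1 := (isLittleO_second_order hG).comp_tendsto (tendsto_add_smul (z := z) ht0 hw)
  have h2 : (fun i => ‖z + t i • w i - z‖ ^ 2) =O[l] fun i => t i ^ 2 := by
    have : (fun i => ‖w i‖ ^ 2) =O[l] fun _ => (1:ℝ) := (hw.norm.pow 2).isBigO_one ℝ
    refine ((Asymptotics.isBigO_refl (fun i => t i ^ 2) l).mul this).congr (fun i => ?_) fun i => by simp
    rw [add_sub_cancel_left, norm_smul, mul_pow, Real.norm_eq_abs, sq_abs]
  have h3 := (h1.trans_isBigO h2).tendsto_inv_smul_nhds_zero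
  have h4 : Tendsto (fun i => (1 / 2 : ℝ) • B (w i) (w i)) l (𝓝 ((1 / 2 : ℝ) • B v v)) :=
    (tendsto_clm_apply (tendsto_clm_apply tendsto_const_nhds hw) hw).const_smul _
  have h5 := h3.add h4
  rw [zero_add] at h5
  refine h5.congr' ?_
  filter_upwards [ht] with i hi
  have hne : t i ^ 2 ≠ 0 := by positivity
  simp only [Function.comp_apply, add_sub_cancel_left, map_smul, smul_apply, ← hB]
  have h6 : (1 / 2 : ℝ) • t i • t i • B (w i) (w i) = t i ^ 2 • ((1 / 2 : ℝ) • B (w i) (w i)) := by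
    module
  rw [h6, smul_sub _ _ (t i ^ 2 • _), inv_smul_smul₀ hne, sub_add_cancel]

end Calculus

theorem continuous_projX {P X : Type*} [NormedAddCommGroup P] [NormedSpace ℝ P]
    [NormedAddCommGroup X] [NormedSpace ℝ X] :
    Continuous (projX : StrongDual ℝ (P × X) → StrongDual ℝ X) :=
  ((ContinuousLinearMap.compL ℝ X (P × X) ℝ).flip (ContinuousLinearMap.inr ℝ P X)).continuous

/-! ### The reduced system `G(p, x) ∈ K` -/

section Reduced

variable {P X E : Type*} [NormedAddCommGroup P] [NormedSpace ℝ P]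
  [NormedAddCommGroup X] [NormedSpace ℝ X]
  [NormedAddCommGroup E]

/-- Near `z` the graph of `Γ` is given by the `C²` constraint `G(p, x) ∈ K`, with `G(z) = 0`, and
this constraint is Robinson stable at `z` with modulus `κ`. -/
structure IsReducedSystem [InnerProductSpace ℝ E] (G : P × X → E) (Γ : P → Set X)
    (K : ProperCone ℝ E) (z : P × X) (κ : ℝ) : Prop where
  contDiffAt : ContDiffAt ℝ 2 G z
  map_eq_zero : G z = 0
  mem_iff : ∀ᶠ z' in 𝓝 z, z'.2 ∈ Γ z'.1 ↔ G z' ∈ K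
  nonneg : 0 ≤ κ
  robinson : ∀ᶠ z' in 𝓝 z, ∀ e ∈ K, ∃ x' ∈ Γ z'.1, ‖x' - z'.2‖ ≤ κ * ‖G z' - e‖

theorem hasFDerivAt_partial_snd [NormedSpace ℝ E] {G : P × X → E} {z : P × X}
    (hG : DifferentiableAt ℝ G z) :
    HasFDerivAt (fun x => G (z.1, x)) ((fderiv ℝ G z).comp (ContinuousLinearMap.inr ℝ P X)) z.2 :=
  HasFDerivAt.comp (f := fun x => (z.1, x)) z.2 hG.hasFDerivAt (hasFDerivAt_prodMk_right z.1 z.2)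

theorem hasFDerivAt_partial_fst [NormedSpace ℝ E] {G : P × X → E} {z : P × X}
    (hG : DifferentiableAt ℝ G z) :
    HasFDerivAt (fun p => G (p, z.2)) ((fderiv ℝ G z).comp (ContinuousLinearMap.inl ℝ P X)) z.1 :=
  HasFDerivAt.comp (f := fun p => (p, z.2)) z.1 hG.hasFDerivAt (hasFDerivAt_prodMk_left z.1 z.2)

variable [InnerProductSpace ℝ E] {G : P × X → E} {Γ : P → Set X} {K : ProperCone ℝ E}
  {z : P × X} {κ : ℝ}

namespace IsReducedSystem

theorem differentiableAt (hS : IsReducedSystem G Γ K z κ) : DifferentiableAt ℝ G z :=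
  hS.contDiffAt.differentiableAt (by simp)

theorem hasFDerivAt_fderiv (hS : IsReducedSystem G Γ K z κ) :
    HasFDerivAt (fderiv ℝ G) (fderiv ℝ (fderiv ℝ G) z) z :=
  ((hS.contDiffAt.fderiv_right (m := 1) (by norm_num)).differentiableAt (by simp)).hasFDerivAt

/-- The stability estimate holds on a whole neighborhood and moves only `x`, so at every nearby
point the multiplier rule applies to the fibre with `p` frozen, with the same κ. This uniformity
provides compactness later. -/
theorem eventually_multiplier [FiniteDimensional ℝ X] [FiniteDimensional ℝ E]
    (hS : IsReducedSystem G Γ K z κ) :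
    ∀ᶠ z' in 𝓝 z, ∀ xs ∈ normalCone (Γ z'.1) z'.2, ∃ μ ∈ polarCone (K : Set E),
      ‖μ‖ ≤ κ * ‖xs‖ ∧ μ (G z') = 0 ∧
      (μ.comp (fderiv ℝ G z')).comp (ContinuousLinearMap.inr ℝ P X) = xs := by
  filter_upwards [hS.contDiffAt.eventually (by simp), hS.mem_iff.eventually_nhds,
    hS.robinson.eventually_nhds] with z' h1 h2 h3 xs hxs
  have hc : Tendsto (fun x => (z'.1, x)) (𝓝 z'.2) (𝓝 z') :=
    (Continuous.prodMk_right z'.1).tendsto z'.2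
  have hF : ContDiffAt ℝ 1 (fun x => G (z'.1, x)) z'.2 :=
    ContDiffAt.comp (g := G) (f := fun x => (z'.1, x)) z'.2 (h1.of_le (by norm_num))
      (contDiffAt_const.prodMk contDiffAt_id)
  obtain ⟨μ, hμ, hn, h0, hcomp⟩ := exists_multiplier_of_mem_normalCone K hS.nonneg hF
    ((hc.eventually h2).mono fun x hx => hx.1) (hc.eventually h3) hxs
  rw [(hasFDerivAt_partial_snd (h1.differentiableAt (by simp))).fderiv] at hcomp
  exact ⟨μ, hμ, hn, h0, hcomp⟩

theorem fderiv_mem_of_tendsto (hS : IsReducedSystem G Γ K z κ) {t : ℕ → ℝ} {w : ℕ → P × X}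
    {v : P × X} (ht : ∀ k, 0 < t k) (ht0 : Tendsto t atTop (𝓝 0)) (hw : Tendsto w atTop (𝓝 v))
    (hmem : ∀ k, z + t k • w k ∈ graph Γ) : fderiv ℝ G z v ∈ K := by
  have h1 := tendsto_difference_quotient hS.differentiableAt.hasFDerivAt
    (Eventually.of_forall ht) ht0 hw
  refine K.isClosed.mem_of_tendsto h1 ?_
  filter_upwards [(tendsto_add_smul (z := z) ht0 hw).eventually hS.mem_iff] with k hk
  rw [hS.map_eq_zero, sub_zero]
  exact K.smul_mem (hk.1 (hmem k)) (inv_nonneg.2 (ht k).le)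

theorem tangentCone_graph_subset (hS : IsReducedSystem G Γ K z κ) {w : P × X}
    (hw : w ∈ tangentCone (graph Γ) z) : fderiv ℝ G z w ∈ K := by
  obtain ⟨t, wk, ht, ht0, hwk, hmem⟩ := hw
  exact hS.fderiv_mem_of_tendsto ht ht0 hwk hmem

theorem tangentCone_fiber_subset (hS : IsReducedSystem G Γ K z κ) {u : X}
    (hu : u ∈ tangentCone (Γ z.1) z.2) : fderiv ℝ G z (0, u) ∈ K := by
  obtain ⟨t, uk, ht, ht0, huk, hmem⟩ := hu
  refine hS.fderiv_mem_of_tendsto (w := fun k => (0, uk k)) ht ht0 (tendsto_const_nhds.prodMk_nhds huk)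
    fun k => ?_
  simpa [graph] using hmem k

/-- Convergent multipliers along a sequence of normals. -/
theorem exists_multiplier_seq [FiniteDimensional ℝ X] [FiniteDimensional ℝ E]
    (hS : IsReducedSystem G Γ K z κ) {xs us : StrongDual ℝ X} {v : P × X} {t : ℕ → ℝ}
    {w : ℕ → P × X} {usk : ℕ → StrongDual ℝ X} (ht : ∀ k, 0 < t k) (ht0 : Tendsto t atTop (𝓝 0))
    (hw : Tendsto w atTop (𝓝 v)) (hus : Tendsto usk atTop (𝓝 us))
    (hmem : ∀ k, xs + t k • usk k ∈ normalCone (Γ (z + t k • w k).1) (z + t k • w k).2) :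
    ∃ φ : ℕ → ℕ, StrictMono φ ∧ ∃ m : ℕ → StrongDual ℝ E, ∃ μ ∈ polarCone (K : Set E),
      (∀ k, m k ∈ polarCone (K : Set E)) ∧
      (∀ k, m k (G (z + t (φ k) • w (φ k))) = 0) ∧ (∀ k, G (z + t (φ k) • w (φ k)) ∈ K) ∧
      Tendsto m atTop (𝓝 μ) ∧
      Tendsto (fun k => projX ((t (φ k))⁻¹ • (m k - μ).comp (fderiv ℝ G z))) atTop
        (𝓝 (us - projX (μ.comp (fderiv ℝ (fderiv ℝ G) z v)))) ∧
      projX (μ.comp (fderiv ℝ G z)) = xs ∧ fderiv ℝ G z v ∈ K ∧ μ (fderiv ℝ G z v) = 0 := by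
  have hproper : ProperSpace (StrongDual ℝ E) := FiniteDimensional.proper ℝ _
  have hz := tendsto_add_smul (z := z) ht0 hw
  -- The normal cone is empty off the set, so a normal certifies feasibility.
  have hgr : ∀ k, z + t k • w k ∈ graph Γ := fun k => (hmem k).1
  obtain ⟨N, hN⟩ := eventually_atTop.1
    ((hz.eventually hS.eventually_multiplier).and (hz.eventually hS.mem_iff))
  have hmul := fun k (hk : N ≤ k) => (hN k hk).1 _ (hmem k)
  choose! m hmK hmn hm0 hmc using hmul
  have hxlim : Tendsto (fun k => xs + t k • usk k) atTop (𝓝 xs) := tendsto_add_smul ht0 hus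
  obtain ⟨R, hR⟩ := (hxlim.norm.const_mul κ).bddAbove_range
  obtain ⟨μ, -, φ, hφ, hμ⟩ := tendsto_subseq_of_bounded
    (s := Metric.closedBall (0 : StrongDual ℝ E) R)
    Metric.isBounded_closedBall (x := fun k => m (k + N)) (fun k => by
      rw [mem_closedBall_zero_iff]
      exact (hmn _ (Nat.le_add_left _ _)).trans (hR ⟨k + N, rfl⟩))
  have hle : ∀ k, N ≤ φ k + N := fun k => Nat.le_add_left _ _
  have hψ : Tendsto (fun k => φ k + N) atTop atTop :=
    (tendsto_add_atTop_nat N).comp hφ.tendsto_atTop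
  have ht' : ∀ᶠ k in atTop, 0 < t (φ k + N) := Eventually.of_forall fun k => ht _
  have hμK : μ ∈ polarCone (K : Set E) := fun e he =>
    le_of_tendsto' (tendsto_clm_apply hμ tendsto_const_nhds) fun k => hmK _ (hle k) e he
  have hcomp : ∀ k, projX ((m (φ k + N)).comp (fderiv ℝ G (z + t (φ k + N) • w (φ k + N)))) =
      xs + t (φ k + N) • usk (φ k + N) := fun k => hmc _ (hle k)
  have hμxs : projX (μ.comp (fderiv ℝ G z)) = xs := by
    have h1 : Tendsto (fun k => projX ((m (φ k + N)).comp
        (fderiv ℝ G (z + t (φ k + N) • w (φ k + N))))) atTop (𝓝 (projX (μ.comp (fderiv ℝ G z)))) :=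
      (continuous_projX.tendsto _).comp (tendsto_clm_comp hμ
        ((hS.hasFDerivAt_fderiv.continuousAt.tendsto.comp hz).comp hψ))
    exact tendsto_nhds_unique h1 ((hxlim.comp hψ).congr fun k => (hcomp k).symm)
  have hAv := hS.fderiv_mem_of_tendsto ht ht0 hw hgr
  refine ⟨fun k => φ k + N, fun a b hab => Nat.add_lt_add_right (hφ hab) N, fun k => m (φ k + N), μ,
    hμK, fun k => hmK _ (hle k), fun k => hm0 _ (hle k), fun k => ((hN _ (hle k)).2).1 (hgr _),
    hμ, ?_, hμxs, hAv, ?_⟩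
  -- Subtract `μ ∘ A = xs` from `m_k ∘ ∇G = xs + t us_k` on the `X` part: the change of `∇G`
  -- contributes `μ ∘ ∇²G v` in the limit, and the change of multiplier is what remains.
  · have h1 := tendsto_difference_quotient hS.hasFDerivAt_fderiv ht' (ht0.comp hψ) (hw.comp hψ)
    have h2 := (hus.comp hψ).sub ((continuous_projX.tendsto _).comp (tendsto_clm_comp hμ h1))
    refine h2.congr fun k => ?_
    have h3 := hcomp k
    have hne := (ht (φ k + N)).ne'
    ext x
    have h4 := DFunLike.congr_fun h3 x
    have h5 := DFunLike.congr_fun hμxs x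
    simp only [projX, ContinuousLinearMap.comp_apply, add_apply, smul_apply,
      smul_eq_mul, Function.comp_apply, sub_apply, map_sub, map_smul] at h4 h5 ⊢
    rw [h4, h5]
    field_simp
    ring
  -- Divide the complementarity relation `m_k(G) = 0` by `t` and pass to the limit.
  · have h1 := tendsto_clm_apply hμ (tendsto_difference_quotient hS.differentiableAt.hasFDerivAt
      ht' (ht0.comp hψ) (hw.comp hψ))
    refine tendsto_nhds_unique h1 (tendsto_const_nhds.congr fun k => ?_)
    have := hm0 _ (hle k)
    simp only [Function.comp_apply, map_smul, hS.map_eq_zero, this, sub_zero, smul_zero]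

end IsReducedSystem

end Reduced

/-! ### Outer estimates from sequences of normals -/

section Upper

variable {P X E : Type*} [NormedAddCommGroup P] [NormedSpace ℝ P]
  [NormedAddCommGroup X] [NormedSpace ℝ X] 
  [NormedAddCommGroup E] [InnerProductSpace ℝ E]
  {G : P × X → E} {Γ : P → Set X} {K : ProperCone ℝ E} {z : P × X} {κ : ℝ}

/-- A linear map solving `y - f x ∈ L` for `y ∈ rge f + L`. -/
theorem exists_linear_selection {V W : Type*} [AddCommGroup V] [Module ℝ V] [AddCommGroup W]
    [Module ℝ W] (f : V →ₗ[ℝ] W) (L : Submodule ℝ W) :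
    ∃ T : W →ₗ[ℝ] V, ∀ x, ∀ l ∈ L, f x + l - f (T (f x + l)) ∈ L := by
  -- Modulo `L` the task is to invert `f` on its range; a right inverse there is extended linearly
  -- to the whole quotient.
  let F : V →ₗ[ℝ] W ⧸ L := L.mkQ.comp f
  obtain ⟨s, hs⟩ := F.rangeRestrict.exists_rightInverse_of_surjective F.range_rangeRestrict
  obtain ⟨S, hS⟩ := s.exists_extend
  refine ⟨S.comp L.mkQ, fun x l hl => ?_⟩
  refine (Submodule.Quotient.mk_eq_zero L).1 ?_
  change L.mkQ _ = 0
  rw [map_sub, sub_eq_zero]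
  have h1 : L.mkQ (f x + l) = F x := by
    have h0 : L.mkQ l = 0 := (Submodule.Quotient.mk_eq_zero L).2 hl
    rw [map_add, h0, add_zero]
    rfl
  have h2 : S (F x) = s (F.rangeRestrict x) := LinearMap.congr_fun hS (F.rangeRestrict x)
  have h3 := congrArg Subtype.val (LinearMap.congr_fun hs (F.rangeRestrict x))
  rw [LinearMap.comp_apply, h1, h2]
  exact h3.symm

/-- The lineality space of a closed convex cone. -/
def lineality (K : ProperCone ℝ E) : Submodule ℝ E where
  carrier := (K : Set E) ∩ -(K : Set E)
  add_mem' := fun {a b} ha hb => ⟨K.add_mem ha.1 hb.1, by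
    rw [Set.mem_neg, neg_add]; exact K.add_mem ha.2 hb.2⟩
  zero_mem' := ⟨K.zero_mem, by rw [Set.mem_neg, neg_zero]; exact K.zero_mem⟩
  smul_mem' := fun c a ha => by
    rcases le_total 0 c with hc | hc
    · exact ⟨K.smul_mem ha.1 hc, by rw [Set.mem_neg, ← smul_neg]; exact K.smul_mem ha.2 hc⟩
    · refine ⟨?_, ?_⟩
      · have : -c • -a ∈ K := K.smul_mem ha.2 (neg_nonneg.2 hc)
        simpa using this
      · rw [Set.mem_neg, ← neg_smul]; exact K.smul_mem ha.1 (neg_nonneg.2 hc)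

theorem polarCone_apply_lineality {μ : StrongDual ℝ E} (hμ : μ ∈ polarCone (K : Set E)) {l : E}
    (hl : l ∈ lineality K) : μ l = 0 := by
  refine le_antisymm (hμ l hl.1) ?_
  have := hμ (-l) hl.2
  rw [map_neg] at this
  linarith

variable [FiniteDimensional ℝ X] [FiniteDimensional ℝ E]

namespace IsReducedSystem

/-- On a critical direction of the fibre μ vanishes and every `m_k` is nonpositive, so the quotients
`t⁻¹ (m_k - μ) ∘ A` are nonpositive there, and so is the limit of their projections. -/
theorem upper_estimate (hS : IsReducedSystem G Γ K z κ) {xs us : StrongDual ℝ X} {v : P × X}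
    (h : us ∈ graphicalDeriv (fun z' : P × X => normalCone (Γ z'.1) z'.2) z xs v) :
    ∃ μ ∈ polarCone (K : Set E), fderiv ℝ G z v ∈ K ∧ μ (fderiv ℝ G z v) = 0 ∧
      projX (μ.comp (fderiv ℝ G z)) = xs ∧
      us - projX (μ.comp (fderiv ℝ (fderiv ℝ G) z v)) ∈ polarCone (criticalCone (Γ z.1) z.2 xs) := by
  obtain ⟨t, wk, ht, ht0, hwk, hmem⟩ := h
  obtain ⟨φ, -, m, μ, hμ, hmK, -, -, -, hlim, hxs, hAv, hμv⟩ := hS.exists_multiplier_seq ht ht0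
    hwk.fst_nhds hwk.snd_nhds hmem
  refine ⟨μ, hμ, hAv, hμv, hxs, fun u hu => ?_⟩
  refine le_of_tendsto' (tendsto_clm_apply hlim tendsto_const_nhds) fun k => ?_
  have h1 : m k (fderiv ℝ G z (0, u)) ≤ 0 := hmK k _ (hS.tangentCone_fiber_subset hu.1)
  have h2 : μ (fderiv ℝ G z (0, u)) = 0 := by
    have := hu.2
    exact (DFunLike.congr_fun hxs u).trans this
  change (t (φ k))⁻¹ * (m k (fderiv ℝ G z (0, u)) - μ (fderiv ℝ G z (0, u))) ≤ 0
  rw [h2, sub_zero]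
  exact mul_nonpos_of_nonneg_of_nonpos (inv_nonneg.2 (ht _).le) h1

/-- Here `S` stands for the characteristic subspace. Its role is to make `⟨W_k, w_k - v⟩` vanish in
the limit although only the projections of `W_k` to `X^*` are bounded a priori. -/
theorem lower_estimate_of_seq (hS : IsReducedSystem G Γ K z κ) {xs us : StrongDual ℝ X} {v : P × X}
    {t : ℕ → ℝ} {w : ℕ → P × X} {usk : ℕ → StrongDual ℝ X} (ht : ∀ k, 0 < t k)
    (ht0 : Tendsto t atTop (𝓝 0)) (hw : Tendsto w atTop (𝓝 v)) (hus : Tendsto usk atTop (𝓝 us))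
    (hmem : ∀ k, xs + t k • usk k ∈ normalCone (Γ (z + t k • w k).1) (z + t k • w k).2)
    {S : Set P} (hS0 : (0 : P) ∈ S)
    (hSL : ∀ q ∈ S, ∃ x : X, ∃ l ∈ lineality K, fderiv ℝ G z (q, 0) = fderiv ℝ G z (0, x) + l)
    {M : ℝ} (hM : ∀ᶠ k in atTop, Metric.infDist ((w k).1 - v.1) S / t k ≤ M) :
    ∃ μ ∈ polarCone (K : Set E), fderiv ℝ G z v ∈ K ∧ μ (fderiv ℝ G z v) = 0 ∧
      projX (μ.comp (fderiv ℝ G z)) = xs ∧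
      (∀ μ' ∈ polarCone (K : Set E), μ'.comp (fderiv ℝ G z) = μ.comp (fderiv ℝ G z) →
        μ' (fderiv ℝ (fderiv ℝ G) z v v) ≤ μ (fderiv ℝ (fderiv ℝ G) z v v)) ∧
      ∃ W : ℕ → StrongDual ℝ (P × X),
        (∀ k, W k ∈ polarCone {y | fderiv ℝ G z y ∈ K ∧ μ (fderiv ℝ G z y) = 0}) ∧
        Tendsto (fun k => projX (W k)) atTop
          (𝓝 (us - projX (μ.comp (fderiv ℝ (fderiv ℝ G) z v)))) ∧
        Tendsto (fun k => W k v) atTop (𝓝 0) := by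
  obtain ⟨φ, hφ, m, μ, hμ, hmK, hm0, hGK, hmlim, hlim, hxs, hAv, hμv⟩ :=
    hS.exists_multiplier_seq ht ht0 hw hus hmem
  have hφ' := hφ.tendsto_atTop
  set A := fderiv ℝ G z with hA
  set b := fderiv ℝ (fderiv ℝ G) z v v with hb
  set W : ℕ → StrongDual ℝ (P × X) := fun k => (t (φ k))⁻¹ • (m k - μ).comp A with hW
  have hWapp : ∀ k y, W k y = (t (φ k))⁻¹ * (m k (A y) - μ (A y)) := fun k y => rfl
  have htφ : ∀ k, 0 < t (φ k) := fun k => ht _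
  have htφ0 : Tendsto (fun k => t (φ k)) atTop (𝓝 0) := ht0.comp hφ'
  have hwφ : Tendsto (fun k => w (φ k)) atTop (𝓝 v) := hw.comp hφ'
  have hWpol : ∀ k, W k ∈ polarCone {y | A y ∈ K ∧ μ (A y) = 0} := by
    intro k y hy
    rw [hWapp, hy.2, sub_zero]
    exact mul_nonpos_of_nonneg_of_nonpos (inv_nonneg.2 (htφ k).le) (hmK k _ hy.1)
  -- The scalar products `⟨W k, w (φ k) - v⟩` tend to zero.
  have hD : Tendsto (fun k => W k (w (φ k) - v)) atTop (𝓝 0) := by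
    -- Choosing the preimage linearly makes `a` below bounded by a multiple of `‖q‖`, so it tends to
    -- zero together with `q`.
    obtain ⟨T₀, hT₀⟩ := exists_linear_selection
      (A.comp (ContinuousLinearMap.inr ℝ P X)).toLinearMap (lineality K)
    let T : E →L[ℝ] X := T₀.toContinuousLinearMap
    have hT : ∀ x, ∀ l ∈ lineality K, A (0, x) + l - A (0, T (A (0, x) + l)) ∈ lineality K := hT₀
    let AP : P →L[ℝ] E := A.comp (ContinuousLinearMap.inl ℝ P X)
    have hbound : ∀ᶠ k in atTop, ‖W k (w (φ k) - v)‖ ≤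
        ‖projX (W k)‖ * (‖T‖ * (‖AP‖ * (‖(w (φ k)).1 - v.1‖ + (M + 1) * t (φ k))) +
          ‖(w (φ k)).2 - v.2‖) + ‖m k - μ‖ * (‖AP‖ * (M + 1)) := by
      filter_upwards [hφ'.eventually hM] with k hk
      rw [div_le_iff₀ (htφ k)] at hk
      have hk' : Metric.infDist ((w (φ k)).1 - v.1) S < (M + 1) * t (φ k) := by
        have := htφ k; linarith
      obtain ⟨q, hqS, hq⟩ := (Metric.infDist_lt_iff ⟨0, hS0⟩).1 hk'
      rw [dist_eq_norm] at hq
      obtain ⟨x, l, hl, hql⟩ := hSL q hqS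
      have hres := hT x l hl
      rw [← hql] at hres
      set a := T (A (q, 0)) with ha
      -- Elements of `K^*` vanish on the lineality space. Thus `W_k` sees the parameter direction
      -- `q` only through the `X` direction `a`, where its projection is bounded.
      have h0 : ∀ ν ∈ polarCone (K : Set E), ν (A (q, 0)) = ν (A (0, a)) := fun ν hν => by
        have := polarCone_apply_lineality hν hres
        rw [map_sub] at this
        linarith
      have hsplit : w (φ k) - v = ((q, 0) + (0, (w (φ k)).2 - v.2)) + ((w (φ k)).1 - v.1 - q, 0) := by
        ext <;> simp
      have hWq : W k (q, 0) = W k (0, a) := by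
        rw [hWapp, hWapp, h0 _ (hmK k), h0 _ hμ]
      have hWx : ∀ x', W k (0, x') = projX (W k) x' := fun x' => rfl
      have hval : W k (w (φ k) - v) = projX (W k) (a + ((w (φ k)).2 - v.2)) +
          (t (φ k))⁻¹ * (m k - μ) (AP ((w (φ k)).1 - v.1 - q)) := by
        rw [hsplit, map_add (W k), map_add (W k), hWq, hWx, hWx, map_add]; rfl
      rw [hval]
      have hqn : ‖q‖ ≤ ‖(w (φ k)).1 - v.1‖ + (M + 1) * t (φ k) := by
        have := norm_sub_norm_le q ((w (φ k)).1 - v.1)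
        rw [norm_sub_rev q] at this
        linarith
      have han : ‖a‖ ≤ ‖T‖ * (‖AP‖ * (‖(w (φ k)).1 - v.1‖ + (M + 1) * t (φ k))) := by
        refine (T.le_opNorm _).trans ?_
        gcongr
        refine (AP.le_opNorm q).trans ?_
        gcongr
      refine (norm_add_le _ _).trans (add_le_add ?_ ?_)
      · refine ((projX (W k)).le_opNorm _).trans ?_
        gcongr
        exact (norm_add_le _ _).trans (by gcongr)
      · rw [norm_mul, norm_inv, Real.norm_of_nonneg (htφ k).le, inv_mul_le_iff₀ (htφ k)]
        refine ((m k - μ).le_opNorm _).trans ?_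
        calc ‖m k - μ‖ * ‖AP ((w (φ k)).1 - v.1 - q)‖
            ≤ ‖m k - μ‖ * (‖AP‖ * ((M + 1) * t (φ k))) := by
              gcongr
              refine (AP.le_opNorm _).trans ?_
              gcongr
          _ = t (φ k) * (‖m k - μ‖ * (‖AP‖ * (M + 1))) := by ring
    have h1 : Tendsto (fun k => ‖(w (φ k)).1 - v.1‖) atTop (𝓝 0) := by
      simpa using (hwφ.fst_nhds.sub_const v.1).norm
    have h2 : Tendsto (fun k => ‖(w (φ k)).2 - v.2‖) atTop (𝓝 0) := by
      simpa using (hwφ.snd_nhds.sub_const v.2).norm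
    have h3 : Tendsto (fun k => ‖m k - μ‖) atTop (𝓝 0) := by
      simpa using (hmlim.sub_const μ).norm
    have h4 := (hlim.norm.mul (((((h1.add (htφ0.const_mul (M + 1))).const_mul ‖AP‖).const_mul ‖T‖)).add h2)).add
      (h3.mul_const (‖AP‖ * (M + 1)))
    simp only [mul_zero, add_zero, zero_mul] at h4
    exact squeeze_zero_norm' hbound h4
  -- Second-order expansion along the sequence.
  set R : ℕ → E := fun k => (t (φ k) ^ 2)⁻¹ • (G (z + t (φ k) • w (φ k)) - G z - t (φ k) • A (w (φ k)))
    with hR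
  have hRlim : Tendsto R atTop (𝓝 ((1 / 2 : ℝ) • b)) :=
    tendsto_second_order_quotient hS.contDiffAt (Eventually.of_forall htφ) htφ0 hwφ
  have hRapp : ∀ (ν : StrongDual ℝ E) k, ν (R k) =
      (t (φ k) ^ 2)⁻¹ * ν (G (z + t (φ k) • w (φ k))) - (t (φ k))⁻¹ * ν (A (w (φ k))) := by
    intro ν k
    have hne := (htφ k).ne'
    simp only [hR, hS.map_eq_zero, sub_zero, map_smul, map_sub, smul_eq_mul]
    field_simp
  -- Feasibility gives only an inequality for general `ν`; for `m k` complementarity turns it into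
  -- an equality, used in `hWv`.
  have hRle : ∀ ν ∈ polarCone (K : Set E), ∀ k, ν (R k) ≤ -((t (φ k))⁻¹ * ν (A (w (φ k)))) := by
    intro ν hν k
    rw [hRapp]
    have := mul_nonpos_of_nonneg_of_nonpos (inv_nonneg.2 (sq_nonneg (t (φ k)))) (hν _ (hGK k))
    linarith
  have hmR : Tendsto (fun k => m k (R k)) atTop (𝓝 ((1 / 2 : ℝ) * μ b)) := by
    simpa using tendsto_clm_apply hmlim hRlim
  have hνR : ∀ ν : StrongDual ℝ E, Tendsto (fun k => ν (R k)) atTop (𝓝 ((1 / 2 : ℝ) * ν b)) := by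
    intro ν
    simpa using tendsto_clm_apply (tendsto_const_nhds (x := ν)) hRlim
  have hWv : ∀ k, W k v = -m k (R k) - (t (φ k))⁻¹ * μ (A (w (φ k))) - W k (w (φ k) - v) := by
    intro k
    rw [hRapp, hm0, map_sub, hWapp k (w (φ k))]
    ring
  -- From above `v` is critical for μ; from below `m k` and μ have the same limiting value on the
  -- second-order quotients.
  have hWv0 : Tendsto (fun k => W k v) atTop (𝓝 0) := by
    have hlow : Tendsto (fun k => -m k (R k) + μ (R k) - W k (w (φ k) - v)) atTop (𝓝 0) := by
      simpa using ((hmR.neg.add (hνR μ)).sub hD)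
    refine tendsto_of_tendsto_of_tendsto_of_le_of_le hlow tendsto_const_nhds (fun k => ?_) fun k => ?_
    · have := hRle μ hμ k
      simp only [hWv k]
      linarith
    · exact hWpol k v ⟨hAv, hμv⟩
  refine ⟨μ, hμ, hAv, hμv, hxs, fun μ' hμ' hcomp => ?_, W, hWpol, hlim, hWv0⟩
  -- With `⟨W_k, v⟩ → 0` the inequality `hRle` is asymptotically tight for μ. A competitor `μ'` has
  -- the same right-hand side, since it agrees with μ on the range of `A`.
  have hlim1 : Tendsto (fun k => -((t (φ k))⁻¹ * μ (A (w (φ k))))) atTop (𝓝 ((1 / 2 : ℝ) * μ b)) := by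
    have := (hWv0.add hmR).add hD
    rw [zero_add, add_zero] at this
    refine this.congr fun k => ?_
    rw [hWv k]
    ring
  have := le_of_tendsto_of_tendsto' (hνR μ') hlim1 fun k => by
    have h1 := hRle μ' hμ' k
    have h2 : μ' (A (w (φ k))) = μ (A (w (φ k))) := DFunLike.congr_fun hcomp (w (φ k))
    rwa [h2] at h1
  linarith

end IsReducedSystem

end Upper

/-! ### Asymptotic conic duality and polars of critical cones -/

section Duality

variable {A E : Type*} [NormedAddCommGroup A] [NormedSpace ℝ A]
  [NormedAddCommGroup E] [NormedSpace ℝ E]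

/-- Strong duality for conic linear programs, up to closure: if `μ` maximizes `b` over the
multipliers `μ' ∈ K^*` with `μ' ∘ T = μ ∘ T`, then the dual program has asymptotically feasible
points with asymptotically the same value. -/
theorem exists_approx_dual_solution (K : ProperCone ℝ E) (T : A →L[ℝ] E) {μ : StrongDual ℝ E}
    (hμ : μ ∈ polarCone (K : Set E)) {b : E}
    (hmax : ∀ μ' ∈ polarCone (K : Set E), μ'.comp T = μ.comp T → μ' b ≤ μ b) {η : ℝ} (hη : 0 < η) :
    ∃ w : A, ∃ e ∈ K, ‖T w + b - e‖ ≤ η ∧ -μ b - η ≤ μ (T w) := by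
  let Q : PointedCone ℝ (E × ℝ) :=
    { carrier := {x | ∃ w : A, ∃ e ∈ K, ∃ s : ℝ, 0 ≤ s ∧ x = (T w - e, μ (T w) - s)}
      add_mem' := by
        rintro _ _ ⟨w, e, he, s, hs, rfl⟩ ⟨w', e', he', s', hs', rfl⟩
        refine ⟨w + w', e + e', K.add_mem he he', s + s', add_nonneg hs hs', ?_⟩
        ext
        · simp only [Prod.mk_add_mk, map_add]; abel
        · simp only [Prod.mk_add_mk, map_add]; ring
      zero_mem' := ⟨0, 0, K.zero_mem, 0, le_rfl, by ext <;> simp⟩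
      smul_mem' := by
        rintro ⟨c, hc⟩ _ ⟨w, e, he, s, hs, rfl⟩
        refine ⟨c • w, c • e, K.smul_mem he hc, c * s, mul_nonneg hc hs, ?_⟩
        change c • (T w - e, μ (T w) - s) = _
        ext
        · simp only [Prod.smul_mk, map_smul, smul_sub]
        · simp only [Prod.smul_mk, map_smul, smul_eq_mul, mul_sub] }
  -- `Q` collects the pairs of residual and value, the latter up to slack. A functional separating
  -- the target pair from it yields a multiplier better than μ.
  have hmem : (-b, -μ b) ∈ closure (Q : Set (E × ℝ)) := by
    by_contra hcon
    obtain ⟨f, hfQ, hfb⟩ := exists_separating_of_notMem_closure Q hcon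
    set lam : StrongDual ℝ E := f.comp (ContinuousLinearMap.inl ℝ E ℝ) with hlam
    set β : ℝ := f (0, 1) with hβ
    have hf : ∀ y s, f (y, s) = lam y + s * β := by
      intro y s
      have : (y, s) = (y, (0:ℝ)) + s • ((0:E), (1:ℝ)) := by simp
      rw [this, map_add, map_smul, smul_eq_mul]; rfl
    have hQ : ∀ w : A, ∀ e ∈ K, ∀ s : ℝ, 0 ≤ s → lam (T w - e) + (μ (T w) - s) * β ≤ 0 := by
      intro w e he s hs
      rw [← hf]
      exact hfQ _ ⟨w, e, he, s, hs, rfl⟩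
    have hβ0 : 0 ≤ β := by
      have := hQ 0 0 K.zero_mem 1 zero_le_one
      simp only [map_zero, sub_zero, zero_sub, zero_add] at this
      linarith
    have hνK : -lam ∈ polarCone (K : Set E) := by
      intro e he
      have := hQ 0 e he 0 le_rfl
      simpa using this
    have hνT : ∀ w, (-lam) (T w) = β * μ (T w) := by
      intro w
      have h1 := hQ w 0 K.zero_mem 0 le_rfl
      have h2 := hQ (-w) 0 K.zero_mem 0 le_rfl
      simp only [map_neg, sub_zero] at h1 h2
      simp only [neg_apply]
      linarith
    have hνb : β * μ b < (-lam) b := by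
      rw [hf] at hfb
      simp only [map_neg] at hfb
      simp only [neg_apply]
      linarith
    -- For `β = 0` the functional is an improving recession direction to add to μ; for `β > 0`
    -- normalizing by `β` gives a feasible competitor.
    rcases hβ0.eq_or_lt with h0 | hpos
    · have h1 := hmax (μ + -lam) (fun e he => add_nonpos (hμ e he) (hνK e he)) (by
        ext w
        have := hνT w
        rw [← h0, zero_mul] at this
        simp only [ContinuousLinearMap.comp_apply, add_apply, this, add_zero])
      rw [← h0, zero_mul] at hνb
      rw [add_apply] at h1
      linarith
    · have h1 := hmax (β⁻¹ • -lam)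
        (fun e he => mul_nonpos_of_nonneg_of_nonpos (inv_nonneg.2 hβ0) (hνK e he)) (by
        ext w
        simp only [ContinuousLinearMap.comp_apply, smul_apply, hνT w, smul_eq_mul]
        field_simp)
      rw [smul_apply, smul_eq_mul, inv_mul_le_iff₀ hpos] at h1
      linarith
  obtain ⟨_, ⟨w, e, he, s, hs, rfl⟩, hd⟩ := Metric.mem_closure_iff.1 hmem η hη
  rw [dist_eq_norm, Prod.mk_sub_mk] at hd
  have h1 := (norm_fst_le _).trans hd.le
  have h2 := (norm_snd_le _).trans hd.le
  refine ⟨w, e, he, ?_, ?_⟩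
  · rw [← norm_neg]
    refine le_trans (le_of_eq ?_) h1
    congr 1
    simp only
    abel
  · have := (abs_le.1 h2).2
    simp only at this
    linarith

/-- Elements of the polar of `{y | T y ∈ K, μ (T y) = 0}` are limits of `ν ∘ T - α μ ∘ T` with
`ν ∈ K^*`. -/
theorem exists_approx_of_mem_polarCone [FiniteDimensional ℝ A] (K : ProperCone ℝ E) (T : A →L[ℝ] E)
    (μ : StrongDual ℝ E) {ws : StrongDual ℝ A}
    (hws : ws ∈ polarCone {y | T y ∈ K ∧ μ (T y) = 0}) {η : ℝ} (hη : 0 < η) :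
    ∃ ν ∈ polarCone (K : Set E), ∃ α : ℝ, ‖ν.comp T - α • μ.comp T - ws‖ ≤ η := by
  let Q : PointedCone ℝ (StrongDual ℝ A) :=
    { carrier := {x | ∃ ν ∈ polarCone (K : Set E), ∃ α : ℝ, x = ν.comp T - α • μ.comp T}
      add_mem' := by
        rintro _ _ ⟨ν, hν, α, rfl⟩ ⟨ν', hν', α', rfl⟩
        refine ⟨ν + ν', fun e he => add_nonpos (hν e he) (hν' e he), α + α', ?_⟩
        rw [ContinuousLinearMap.add_comp, add_smul]; abel
      zero_mem' := ⟨0, fun e _ => le_rfl, 0, by simp⟩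
      smul_mem' := by
        rintro ⟨c, hc⟩ _ ⟨ν, hν, α, rfl⟩
        refine ⟨c • ν, fun e he => mul_nonpos_of_nonneg_of_nonpos hc (hν e he), c * α, ?_⟩
        change c • (ν.comp T - α • μ.comp T) = _
        rw [ContinuousLinearMap.smul_comp, smul_sub, smul_smul] }
  have hmem : ws ∈ closure (Q : Set (StrongDual ℝ A)) := by
    by_contra hcon
    obtain ⟨f, hfQ, hfw⟩ := exists_separating_of_notMem_closure Q hcon
    obtain ⟨y, hy⟩ := exists_eval_eq f
    rw [hy] at hfw
    have hyK : T y ∈ K := mem_of_polarCone_le K fun ν hν => by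
      have := hfQ _ ⟨ν, hν, 0, rfl⟩
      rw [hy] at this
      simpa using this
    -- The coefficient `α` has free sign, so `±1` force equality.
    have hyμ : μ (T y) = 0 := by
      have h1 := hfQ _ ⟨0, fun e _ => le_rfl, 1, rfl⟩
      have h2 := hfQ _ ⟨0, fun e _ => le_rfl, -1, rfl⟩
      rw [hy] at h1 h2
      simp only [ContinuousLinearMap.zero_comp, zero_sub, neg_apply, smul_apply, one_smul, neg_smul,
        neg_neg, ContinuousLinearMap.comp_apply] at h1 h2
      linarith
    exact absurd (hws y ⟨hyK, hyμ⟩) (not_le.2 hfw)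
  obtain ⟨_, ⟨ν, hν, α, rfl⟩, hd⟩ := Metric.mem_closure_iff.1 hmem η hη
  rw [dist_eq_norm, norm_sub_rev] at hd
  exact ⟨ν, hν, α, hd.le⟩

/-- A uniform first-order estimate with quadratic remainder. -/
theorem exists_quadratic_bound {G : A → E} {z : A} (hG : ContDiffAt ℝ 2 G z) :
    ∃ c : ℝ, 0 ≤ c ∧ ∃ ρ : ℝ, 0 < ρ ∧ ∀ y ∈ Metric.ball z ρ, ∀ y' ∈ Metric.ball z ρ,
      ‖G y' - G y - fderiv ℝ G y (y' - y)‖ ≤ c * ‖y' - y‖ ^ 2 := by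
  obtain ⟨c, s, hs, hlip⟩ := ((hG.fderiv_right (m := 1) (by norm_num)).hasStrictFDerivAt
    (by simp)).exists_lipschitzOnWith
  have h2 : ∀ᶠ y in 𝓝 z, HasFDerivAt G (fderiv ℝ G y) y := by
    filter_upwards [hG.eventually (by simp)] with y hy
    exact (hy.differentiableAt (by simp)).hasFDerivAt
  obtain ⟨ρ, hρ, hball⟩ := Metric.eventually_nhds_iff_ball.1 (h2.and hs)
  refine ⟨c, c.2, ρ, hρ, fun y hy y' hy' => ?_⟩
  have hconv : Convex ℝ (Metric.ball z ρ ∩ Metric.closedBall y ‖y' - y‖) :=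
    (convex_ball _ _).inter (convex_closedBall _ _)
  have := hconv.norm_image_sub_le_of_norm_hasFDerivWithin_le' (f := G) (φ := fderiv ℝ G y)
    (C := c * ‖y' - y‖) (x := y) (y := y') (fun x hx => (hball x hx.1).1.hasFDerivWithinAt)
    (fun x hx => ?_) ⟨hy, Metric.mem_closedBall_self (norm_nonneg _)⟩
    ⟨hy', by rw [Metric.mem_closedBall, dist_eq_norm]⟩
  · exact this.trans (le_of_eq (by ring))
  · have h3 := hlip.dist_le_mul x (hball x hx.1).2 y (hball y hy).2
    rw [dist_eq_norm] at h3
    refine h3.trans ?_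
    have := hx.2
    rw [Metric.mem_closedBall] at this
    gcongr

end Duality

theorem norm_projX_le {P X : Type*} [NormedAddCommGroup P] [NormedSpace ℝ P]
    [NormedAddCommGroup X] [NormedSpace ℝ X] (φ : StrongDual ℝ (P × X)) : ‖projX φ‖ ≤ ‖φ‖ := by
  refine ContinuousLinearMap.opNorm_le_bound _ (norm_nonneg _) fun x => ?_
  refine (φ.le_opNorm (0, x)).trans (le_of_eq ?_)
  simp [Prod.norm_def]

/-! ### Constructing normals in a prescribed direction -/

section Lower

variable {P X E : Type*} [NormedAddCommGroup P] [NormedSpace ℝ P]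
  [NormedAddCommGroup X] [InnerProductSpace ℝ X]
  [NormedAddCommGroup E] [InnerProductSpace ℝ E]
  {G : P × X → E} {Γ : P → Set X} {K : ProperCone ℝ E} {z : P × X} {κ : ℝ}

theorem tendsto_id_nhdsGT : Tendsto (fun t : ℝ => t) (𝓝[>] 0) (𝓝 0) :=
  tendsto_id.mono_left nhdsWithin_le_nhds

namespace IsReducedSystem

/-- `G(z + t w)` differs from `t ∇G(z) w ∈ K` by `o(t)`, so Robinson stability restores feasibility
by an `o(t)` change of `x`, which does not affect the limiting direction. -/
theorem subset_tangentCone_graph (hS : IsReducedSystem G Γ K z κ) {w : P × X}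
    (hw : fderiv ℝ G z w ∈ K) : w ∈ tangentCone (graph Γ) z := by
  refine mem_tangentCone_of_forall fun δ hδ => ?_
  have hpos : ∀ᶠ t : ℝ in 𝓝[>] 0, 0 < t := self_mem_nhdsWithin
  have h1 := tendsto_difference_quotient hS.differentiableAt.hasFDerivAt hpos tendsto_id_nhdsGT
    (tendsto_const_nhds (x := w))
  have h2 : Tendsto (fun t : ℝ => κ * ‖t⁻¹ • (G (z + t • w) - G z) - fderiv ℝ G z w‖) (𝓝[>] 0)
      (𝓝 0) := by
    simpa using ((h1.sub_const (fderiv ℝ G z w)).norm.const_mul κ)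
  obtain ⟨t, ⟨h3, h4⟩, h5⟩ := ((((tendsto_add_smul (z := z) tendsto_id_nhdsGT
    (tendsto_const_nhds (x := w))).eventually hS.robinson).and (h2.eventually_lt_const hδ)).and
    (Ioo_mem_nhdsGT hδ)).exists
  have ht := h5.1
  obtain ⟨x', hx', hx'n⟩ := h3 (t • fderiv ℝ G z w) (K.smul_mem hw ht.le)
  refine ⟨t, ht, h5.2, w + (0, t⁻¹ • (x' - (z + t • w).2)), ?_, ?_⟩
  · rw [add_sub_cancel_left, Prod.norm_mk, norm_zero, max_eq_right (norm_nonneg _), norm_smul,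
      norm_inv, Real.norm_of_nonneg ht.le]
    refine lt_of_le_of_lt ?_ h4
    rw [inv_mul_le_iff₀ ht]
    refine hx'n.trans (le_of_eq ?_)
    have : G (z + t • w) - t • fderiv ℝ G z w =
        t • (t⁻¹ • (G (z + t • w) - G z) - fderiv ℝ G z w) := by
      rw [smul_sub t, smul_inv_smul₀ ht.ne', hS.map_eq_zero, sub_zero]
    rw [this, norm_smul, Real.norm_of_nonneg ht.le]
    ring
  · have : z + t • (w + (0, t⁻¹ • (x' - (z + t • w).2))) = ((z + t • w).1, x') := by
      ext
      · simp
      · simp [smul_smul, ht.ne']; abel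
    rw [this]
    exact hx'

variable [FiniteDimensional ℝ X]

/-- Points of the graph of the normal cone mapping in a prescribed direction, constructed from
approximate solutions of the dual program. -/
theorem eventually_exists_near (hS : IsReducedSystem G Γ K z κ) {v : P × X}
    (hv : fderiv ℝ G z v ∈ K) {μ : StrongDual ℝ E} (hμ : μ ∈ polarCone (K : Set E))
    (hμv : μ (fderiv ℝ G z v) = 0) :
    ∃ c : ℝ, 0 ≤ c ∧ ∀ θ : ℝ, 0 < θ → ∀ (w : P × X), ∀ e ∈ K,
      ‖fderiv ℝ G z w + fderiv ℝ (fderiv ℝ G) z v v - e‖ ≤ θ ^ 2 →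
      -μ (fderiv ℝ (fderiv ℝ G) z v v) - θ ^ 2 ≤ μ (fderiv ℝ G z w) →
      ∀ ν ∈ polarCone (K : Set E), ∀ α : ℝ, -θ ^ 2 ≤ ν (fderiv ℝ G z v) →
      ∀ δ : ℝ, 0 < δ → ∀ᶠ t : ℝ in 𝓝[>] 0, ∃ v' : P × X, ∃ us : StrongDual ℝ X,
        ‖v' - v‖ ≤ θ + δ ∧
        ‖us - projX (μ.comp (fderiv ℝ (fderiv ℝ G) z v) +
          (ν.comp (fderiv ℝ G z) - α • μ.comp (fderiv ℝ G z)))‖ ≤ c * θ + δ ∧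
        projX (μ.comp (fderiv ℝ G z)) + t • us ∈ normalCone (Γ (z + t • v').1) (z + t • v').2 := by
  obtain ⟨c₀, hc₀, ρ₀, hρ₀, hquad⟩ := exists_quadratic_bound hS.contDiffAt
  set A := fderiv ℝ G z with hA
  set B := fderiv ℝ (fderiv ℝ G) z with hB
  set b := B v v with hb
  have hcont : ∀ᶠ y in 𝓝 z, ContinuousAt G y := by
    filter_upwards [hS.contDiffAt.eventually (by simp)] with y hy using hy.continuousAt
  obtain ⟨ρ₁, hρ₁, hball₁⟩ := Metric.eventually_nhds_iff_ball.1 (hcont.and hS.mem_iff)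
  set ρ := min ρ₀ ρ₁ with hρdef
  have hρ : 0 < ρ := lt_min hρ₀ hρ₁
  have hκ := hS.nonneg
  -- In units of `θ² t²`, the loss in `μ(G)` is `1` from the Taylor remainder, `1/2` from the
  -- approximate dual value, and `‖μ ∘ A‖ κ` from the feasibility correction.
  set c₁ := 3 / 2 + ‖μ.comp A‖ * κ with hc₁
  have hc₁0 : 0 ≤ c₁ := by positivity
  set c := (‖μ‖ + 1) * c₀ + 2 * (c₁ + 1) with hc
  have hcpos : 0 < c := by positivity
  refine ⟨4 * c, by positivity, fun θ hθ w e he hwe hwμ ν hν α hνv δ hδ => ?_⟩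
  have hpos : ∀ᶠ t : ℝ in 𝓝[>] 0, 0 < t := self_mem_nhdsWithin
  have hid := tendsto_id_nhdsGT
  -- The corrected second-order curve.
  set u : ℝ → P × X := fun t => v + (t / 2) • w with hu
  have hulim : Tendsto u (𝓝[>] 0) (𝓝 v) := by
    have h1 : Tendsto (fun t : ℝ => t / 2) (𝓝[>] 0) (𝓝 0) := by simpa using hid.div_const 2
    simpa using (h1.smul_const w).const_add v
  have hG1 : ∀ᶠ t : ℝ in 𝓝[>] 0,
      ‖(t ^ 2)⁻¹ • (G (z + t • u t) - G z - t • A (u t)) - (1 / 2 : ℝ) • b‖ < θ ^ 2 / 2 := by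
    have h1 := ((tendsto_second_order_quotient hS.contDiffAt hpos hid hulim).sub_const
      ((1 / 2 : ℝ) • b)).norm
    rw [sub_self, norm_zero] at h1
    exact h1.eventually_lt_const (by positivity)
  -- The target `t A v + (t²/2) e` lies in `K`; Taylor remainder and dual infeasibility each cost at
  -- most `θ² t² / 2`.
  have hex : ∀ᶠ t : ℝ in 𝓝[>] 0, ∃ x : X, x ∈ Γ (z + t • u t).1 ∧
      ‖x - (z + t • u t).2‖ ≤ κ * (θ ^ 2 * t ^ 2) := by
    filter_upwards [hpos, hG1, (tendsto_add_smul (z := z) hid hulim).eventually hS.robinson]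
      with t ht h1 h2
    obtain ⟨x, hx, hxn⟩ := h2 (t • A v + (t ^ 2 / 2) • e)
      (K.add_mem (K.smul_mem hv ht.le) (K.smul_mem he (by positivity)))
    refine ⟨x, hx, hxn.trans ?_⟩
    gcongr
    have h3 : G (z + t • u t) - (t • A v + (t ^ 2 / 2) • e) =
        t ^ 2 • ((t ^ 2)⁻¹ • (G (z + t • u t) - G z - t • A (u t)) - (1 / 2 : ℝ) • b) +
          (t ^ 2 / 2) • (A w + b - e) := by
      rw [smul_sub (t ^ 2), smul_inv_smul₀ (by positivity), hS.map_eq_zero]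
      simp only [hu, map_add, map_smul]
      module
    rw [h3]
    refine (norm_add_le _ _).trans ?_
    rw [norm_smul, norm_smul, Real.norm_of_nonneg (by positivity),
      Real.norm_of_nonneg (by positivity)]
    have ht2 : 0 < t ^ 2 := by positivity
    nlinarith
  obtain ⟨f, hf⟩ := hex.choice
  set y : ℝ → P × X := fun t => u t + (0, t⁻¹ • (f t - (z + t • u t).2)) with hy
  have hyf : ∀ t : ℝ, 0 < t → z + t • y t = ((z + t • u t).1, f t) := by
    intro t ht
    ext
    · simp [hy]
    · simp [hy, smul_smul, ht.ne']; abel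
  have hyu : ∀ᶠ t : ℝ in 𝓝[>] 0, ‖y t - u t‖ ≤ κ * θ ^ 2 * t := by
    filter_upwards [hpos, hf] with t ht hft
    rw [add_sub_cancel_left, Prod.norm_mk, norm_zero, max_eq_right (norm_nonneg _), norm_smul,
      norm_inv, Real.norm_of_nonneg ht.le, inv_mul_le_iff₀ ht]
    exact hft.2.trans (le_of_eq (by ring))
  have hylim : Tendsto y (𝓝[>] 0) (𝓝 v) := by
    have h1 : Tendsto (fun t => y t - u t) (𝓝[>] 0) (𝓝 0) :=
      squeeze_zero_norm' hyu (by simpa using hid.const_mul (κ * θ ^ 2))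
    simpa using h1.add hulim
  have hzlim := tendsto_add_smul (z := z) hid hylim
  -- The multipliers are almost complementary.
  have hμG : ∀ᶠ t : ℝ in 𝓝[>] 0, -(c₁ * (θ ^ 2 * t ^ 2)) ≤ μ (G (z + t • y t)) := by
    have h1 := tendsto_clm_apply (tendsto_const_nhds (x := μ))
      (tendsto_second_order_quotient hS.contDiffAt hpos hid hylim)
    have h2 : μ ((1 / 2 : ℝ) • b) - θ ^ 2 < μ ((1 / 2 : ℝ) • b) := by
      have : 0 < θ ^ 2 := by positivity
      linarith
    filter_upwards [h1.eventually_const_lt h2, hpos, hyu] with t h3 ht h4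
    have h5 : μ (A (y t)) = t / 2 * μ (A w) + μ.comp A (y t - u t) := by
      simp only [hu, map_sub, map_add, map_smul, ContinuousLinearMap.comp_apply, smul_eq_mul, hμv]
      ring
    have h6 : -(‖μ.comp A‖ * (κ * θ ^ 2 * t)) ≤ μ.comp A (y t - u t) := by
      have := (neg_le_abs _).trans (((μ.comp A).le_opNorm (y t - u t)))
      have h7 : ‖μ.comp A‖ * ‖y t - u t‖ ≤ ‖μ.comp A‖ * (κ * θ ^ 2 * t) := by gcongr
      linarith
    simp only [map_smul, map_sub, hS.map_eq_zero, sub_zero, smul_eq_mul, ← hA] at h3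
    have ht2 : 0 < t ^ 2 := by positivity
    rw [← div_eq_inv_mul, lt_div_iff₀ ht2] at h3
    have h8 : t * (t / 2 * (-μ b - θ ^ 2)) ≤ t * (t / 2 * μ (A w)) := by gcongr
    have h9 : t * -(‖μ.comp A‖ * (κ * θ ^ 2 * t)) ≤ t * μ.comp A (y t - u t) := by gcongr
    rw [h5] at h3
    rw [hc₁]
    linarith
  have hνG : ∀ᶠ t : ℝ in 𝓝[>] 0, -(2 * (θ ^ 2 * t)) ≤ ν (G (z + t • y t)) := by
    have h1 := tendsto_clm_apply (tendsto_const_nhds (x := ν))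
      (tendsto_difference_quotient hS.differentiableAt.hasFDerivAt hpos hid hylim)
    have h2 : -(2 * θ ^ 2) < ν (A v) := by
      have : 0 < θ ^ 2 := by positivity
      linarith
    filter_upwards [h1.eventually_const_lt h2, hpos] with t h3 ht
    simp only [map_smul, hS.map_eq_zero, sub_zero, smul_eq_mul] at h3
    rw [← div_eq_inv_mul, lt_div_iff₀ ht] at h3
    linarith
  -- The derivative of this family is `ν - αμ`, which produces the prescribed polar element; for
  -- small `t` the factor `1 - tα` is positive, so it stays in `K^*`.
  set m : ℝ → StrongDual ℝ E := fun t => (1 - t * α) • μ + t • ν with hm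
  have hαlim : Tendsto (fun t : ℝ => 1 - t * α) (𝓝[>] 0) (𝓝 1) := by
    simpa using (hid.mul_const α).const_sub 1
  have hmlim : Tendsto m (𝓝[>] 0) (𝓝 μ) := by
    simpa using (hαlim.smul_const μ).add (hid.smul_const ν)
  have hmn : ∀ᶠ t : ℝ in 𝓝[>] 0, ‖m t‖ < ‖μ‖ + 1 :=
    hmlim.norm.eventually_lt_const (lt_add_one _)
  have hα0 : ∀ᶠ t : ℝ in 𝓝[>] 0, 0 < 1 - t * α := hαlim.eventually_const_lt zero_lt_one
  have hα2 : ∀ᶠ t : ℝ in 𝓝[>] 0, 1 - t * α < 2 := hαlim.eventually_lt_const one_lt_two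
  have hmG : ∀ᶠ t : ℝ in 𝓝[>] 0, -(2 * (c₁ + 1) * (θ * t) ^ 2) ≤ m t (G (z + t • y t)) := by
    filter_upwards [hμG, hνG, hα0, hα2, hpos] with t h1 h2 h3 h4 ht
    have h5 : (1 - t * α) * -(c₁ * (θ ^ 2 * t ^ 2)) ≤ (1 - t * α) * μ (G (z + t • y t)) := by gcongr
    have h6 : t * -(2 * (θ ^ 2 * t)) ≤ t * ν (G (z + t • y t)) := by gcongr
    have h7 : (1 - t * α) * (c₁ * (θ ^ 2 * t ^ 2)) ≤ 2 * (c₁ * (θ ^ 2 * t ^ 2)) := by gcongr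
    simp only [hm, add_apply, smul_apply, smul_eq_mul]
    linarith
  -- The normals at the curve.
  set xs : ℝ → StrongDual ℝ X := fun t => projX ((m t).comp (fderiv ℝ G (z + t • y t))) with hxs
  have hxslim : Tendsto (fun t => t⁻¹ • (xs t - projX (μ.comp A))) (𝓝[>] 0)
      (𝓝 (projX (μ.comp (B v) + (ν.comp A - α • μ.comp A)))) := by
    have h1 := tendsto_difference_quotient (E := P × X →L[ℝ] E) (F := fderiv ℝ G)
      hS.hasFDerivAt_fderiv hpos hid hylim
    have h2 : Tendsto (fun t => (m t).comp (t⁻¹ • (fderiv ℝ G (z + t • y t) - A)) +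
        (ν.comp A - α • μ.comp A)) (𝓝[>] 0) (𝓝 (μ.comp (B v) + (ν.comp A - α • μ.comp A))) :=
      (tendsto_clm_comp hmlim h1).add_const _
    refine ((continuous_projX.tendsto _).comp h2).congr' ?_
    filter_upwards [hpos] with t ht
    have hne := ht.ne'
    ext x
    simp only [hxs, hm, projX, Function.comp_apply, ContinuousLinearMap.comp_apply, add_apply,
      sub_apply, smul_apply, smul_eq_mul, map_smul, map_sub]
    field_simp
    ring
  have hxsnear : ∀ᶠ t : ℝ in 𝓝[>] 0, ‖t⁻¹ • (xs t - projX (μ.comp A)) -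
      projX (μ.comp (B v) + (ν.comp A - α • μ.comp A))‖ < δ := by
    have h1 := (hxslim.sub_const (projX (μ.comp (B v) + (ν.comp A - α • μ.comp A)))).norm
    rw [sub_self, norm_zero] at h1
    exact h1.eventually_lt_const hδ
  have hynear : ∀ᶠ t : ℝ in 𝓝[>] 0, ‖y t - v‖ < δ := by
    have h1 := (hylim.sub_const v).norm
    rw [sub_self, norm_zero] at h1
    exact h1.eventually_lt_const hδ
  have hθt : ∀ᶠ t : ℝ in 𝓝[>] 0, θ * t < ρ / 2 := by
    have h1 : Tendsto (fun t : ℝ => θ * t) (𝓝[>] 0) (𝓝 0) := by simpa using hid.const_mul θ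
    exact h1.eventually_lt_const (half_pos hρ)
  filter_upwards [hpos, hf, hmG, hmn, hxsnear, hynear, hθt, hα0,
    hzlim.eventually (Metric.ball_mem_nhds z (half_pos hρ))]
    with t ht hft hmGt hmnt hxst hyt hθt hαt hzt
  set p := (z + t • u t).1 with hp
  have hzy := hyf t ht
  have hmK : m t ∈ polarCone (K : Set E) := fun e he => by
    simp only [hm, add_apply, smul_apply, smul_eq_mul]
    have h1 := mul_nonpos_of_nonneg_of_nonpos hαt.le (hμ e he)
    have h2 := mul_nonpos_of_nonneg_of_nonpos ht.le (hν e he)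
    linarith
  have hin : ∀ x ∈ Metric.closedBall (f t) (ρ / 2), (p, x) ∈ Metric.ball z ρ := by
    intro x hx
    have h1 : dist (p, x) (z + t • y t) ≤ ρ / 2 := by
      rw [hzy]
      change max (dist p p) (dist x (f t)) ≤ ρ / 2
      rw [dist_self, max_eq_right dist_nonneg]
      exact hx
    have h2 : dist (z + t • y t) z < ρ / 2 := hzt
    rw [Metric.mem_ball]
    linarith [dist_triangle (p, x) (z + t • y t) z]
  have hin₀ : ∀ x ∈ Metric.closedBall (f t) (ρ / 2), (p, x) ∈ Metric.ball z ρ₀ := fun x hx =>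
    Metric.ball_subset_ball (min_le_left _ _) (hin x hx)
  have hin₁ : ∀ x ∈ Metric.closedBall (f t) (ρ / 2), (p, x) ∈ Metric.ball z ρ₁ := fun x hx =>
    Metric.ball_subset_ball (min_le_right _ _) (hin x hx)
  have hclosed : IsClosed (Γ p ∩ Metric.closedBall (f t) (ρ / 2)) := by
    have h1 : Γ p ∩ Metric.closedBall (f t) (ρ / 2) =
        Metric.closedBall (f t) (ρ / 2) ∩ (fun x => G (p, x)) ⁻¹' (K : Set E) := by
      ext x
      constructor
      · rintro ⟨h1, h2⟩
        exact ⟨h2, ((hball₁ _ (hin₁ x h2)).2).1 h1⟩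
      · rintro ⟨h1, h2⟩
        exact ⟨((hball₁ _ (hin₁ x h1)).2).2 h2, h1⟩
    rw [h1]
    refine ContinuousOn.preimage_isClosed_of_isClosed (fun x hx => ?_) Metric.isClosed_closedBall
      K.isClosed
    exact (ContinuousAt.comp (f := fun x => (p, x)) (hball₁ _ (hin₁ x hx)).1
      (by fun_prop)).continuousWithinAt
  have hfin : (p, f t) ∈ Metric.ball z ρ₀ := hin₀ _ (Metric.mem_closedBall_self (half_pos hρ).le)
  -- Linearize `G(p, ·)` at `f t`: feasibility of `x` gives `m t (G) ≤ 0`, almost complementarity at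
  -- `f t` costs `(θ t)²`, and linearization costs a multiple of `‖x - f t‖²`.
  have hM : ∀ x ∈ Γ p ∩ Metric.closedBall (f t) (ρ / 2),
      xs t (x - f t) ≤ c * (θ * t) ^ 2 + c * ‖x - f t‖ ^ 2 := by
    rintro x ⟨hxΓ, hxb⟩
    have h1 : m t (G (p, x)) ≤ 0 := hmK _ (((hball₁ _ (hin₁ x hxb)).2).1 hxΓ)
    have h2 := hquad _ hfin _ (hin₀ x hxb)
    have h3 : (p, x) - (p, f t) = (0, x - f t) := by simp
    have h4 : ‖((0 : P), x - f t)‖ = ‖x - f t‖ := by simp [Prod.norm_def]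
    rw [h3, h4] at h2
    have h5 : xs t (x - f t) = m t (fderiv ℝ G (p, f t) (0, x - f t)) := by
      simp only [hxs, hzy]; rfl
    have h6 := (neg_le_abs _).trans ((m t).le_opNorm
      (G (p, x) - G (p, f t) - fderiv ℝ G (p, f t) (0, x - f t)))
    have h7 : ‖m t‖ * ‖G (p, x) - G (p, f t) - fderiv ℝ G (p, f t) (0, x - f t)‖ ≤
        (‖μ‖ + 1) * (c₀ * ‖x - f t‖ ^ 2) := by gcongr
    rw [map_sub, map_sub, ← h5] at h6
    rw [hzy] at hmGt
    have h8 : 0 ≤ (‖μ‖ + 1) * c₀ * (θ * t) ^ 2 := by positivity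
    have h9 : 0 ≤ 2 * (c₁ + 1) * ‖x - f t‖ ^ 2 := by positivity
    rw [hc]
    linarith
  obtain ⟨x', hx'Γ, hx'n, xs', hxs'N, hxs'n⟩ := exists_regularNormal_near hft.1 hcpos
    (by positivity) hθt hclosed hM
  refine ⟨y t + (0, t⁻¹ • (x' - f t)), t⁻¹ • (xs' - projX (μ.comp A)), ?_, ?_, ?_⟩
  · have h1 : y t + (0, t⁻¹ • (x' - f t)) - v = (0, t⁻¹ • (x' - f t)) + (y t - v) := by abel
    rw [h1]
    refine (norm_add_le _ _).trans (add_le_add ?_ hyt.le)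
    rw [Prod.norm_mk, norm_zero, max_eq_right (norm_nonneg _), norm_smul, norm_inv,
      Real.norm_of_nonneg ht.le, inv_mul_le_iff₀ ht]
    linarith
  · have h1 : t⁻¹ • (xs' - projX (μ.comp A)) -
        projX (μ.comp (B v) + (ν.comp A - α • μ.comp A)) = t⁻¹ • (xs' - xs t) +
        (t⁻¹ • (xs t - projX (μ.comp A)) -
          projX (μ.comp (B v) + (ν.comp A - α • μ.comp A))) := by
      rw [smul_sub, smul_sub, smul_sub]; abel
    rw [h1]
    refine (norm_add_le _ _).trans (add_le_add ?_ hxst.le)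
    rw [norm_smul, norm_inv, Real.norm_of_nonneg ht.le, inv_mul_le_iff₀ ht]
    linarith
  · have h1 : z + t • (y t + (0, t⁻¹ • (x' - f t))) = (p, x') := by
      rw [smul_add, ← add_assoc, hzy]
      ext
      · simp [hp]
      · simp [smul_smul, ht.ne']
    rw [h1, smul_inv_smul₀ ht.ne', add_sub_cancel]
    exact regularNormalCone_subset_normalCone _ _ hxs'N

/-- Feeds three approximations into `eventually_exists_near`: a dual solution, a member of the
sequence `W`, and its representation through `K^*` and μ. All errors are controlled by one parameter
`θ` proportional to `δ`. -/
theorem lower_inclusion [FiniteDimensional ℝ P] (hS : IsReducedSystem G Γ K z κ) {v : P × X}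
    (hv : fderiv ℝ G z v ∈ K) {μ : StrongDual ℝ E} (hμ : μ ∈ polarCone (K : Set E))
    (hμv : μ (fderiv ℝ G z v) = 0)
    (hmax : ∀ μ' ∈ polarCone (K : Set E), μ'.comp (fderiv ℝ G z) = μ.comp (fderiv ℝ G z) →
      μ' (fderiv ℝ (fderiv ℝ G) z v v) ≤ μ (fderiv ℝ (fderiv ℝ G) z v v))
    {W : ℕ → StrongDual ℝ (P × X)} {wx : StrongDual ℝ X}
    (hW : ∀ k, W k ∈ polarCone {y | fderiv ℝ G z y ∈ K ∧ μ (fderiv ℝ G z y) = 0})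
    (hWx : Tendsto (fun k => projX (W k)) atTop (𝓝 wx))
    (hWv : Tendsto (fun k => W k v) atTop (𝓝 0)) :
    projX (μ.comp (fderiv ℝ (fderiv ℝ G) z v)) + wx ∈
      graphicalDeriv (fun z' : P × X => normalCone (Γ z'.1) z'.2) z
        (projX (μ.comp (fderiv ℝ G z))) v := by
  obtain ⟨c, hc, hev⟩ := hS.eventually_exists_near hv hμ hμv
  refine mem_tangentCone_of_forall fun δ hδ => ?_
  set A := fderiv ℝ G z with hA
  set θ := δ / (4 * (c + 1)) with hθ
  have hθ0 : 0 < θ := by positivity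
  have hθδ : (c + 1) * θ = δ / 4 := by rw [hθ]; field_simp
  obtain ⟨w, e, he, hwe, hwμ⟩ := exists_approx_dual_solution K A hμ hmax (η := θ ^ 2) (by positivity)
  have h1 : ∀ᶠ k in atTop, ‖projX (W k) - wx‖ < δ / 8 := by
    have := (hWx.sub_const wx).norm
    rw [sub_self, norm_zero] at this
    exact this.eventually_lt_const (by positivity)
  have h2 : ∀ᶠ k in atTop, -(θ ^ 2 / 2) < W k v :=
    hWv.eventually_const_lt (by have : 0 < θ ^ 2 := by positivity
                                linarith)
  obtain ⟨k, hk1, hk2⟩ := (h1.and h2).exists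
  -- The second bound keeps `ν(A v)` within `θ²/2` of `W k v`, since `μ(A v) = 0`; together with
  -- `hk2` this gives `hνv`.
  set η := min (δ / 8) (θ ^ 2 / (2 * (‖v‖ + 1))) with hη
  have hη0 : 0 < η := lt_min (by positivity) (by positivity)
  obtain ⟨ν, hν, α, hνα⟩ := exists_approx_of_mem_polarCone K A μ (hW k) hη0
  have hηv : η * ‖v‖ ≤ θ ^ 2 / 2 := by
    have h3 : η ≤ θ ^ 2 / (2 * (‖v‖ + 1)) := min_le_right _ _
    rw [le_div_iff₀ (by positivity)] at h3
    nlinarith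
  have hνv : -θ ^ 2 ≤ ν (A v) := by
    have h3 := (neg_le_abs _).trans (((ν.comp A - α • μ.comp A - W k).le_opNorm v).trans
      (mul_le_mul_of_nonneg_right hνα (norm_nonneg v)))
    simp only [sub_apply, smul_apply, ContinuousLinearMap.comp_apply, hμv, smul_zero, sub_zero] at h3
    linarith
  obtain ⟨t, ht, v', us, hv', hus, hmem⟩ := (Filter.Eventually.and (Ioo_mem_nhdsGT hδ)
    (hev θ hθ0 w e he hwe hwμ ν hν α hνv (δ / 4) (by positivity))).exists
  refine ⟨t, ht.1, ht.2, (v', us), ?_, hmem⟩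
  have hcθ : c * θ + θ = δ / 4 := by linarith
  have hcθ0 : 0 ≤ c * θ := by positivity
  rw [Prod.mk_sub_mk, Prod.norm_mk, max_lt_iff]
  constructor
  · linarith
  · have hproj : projX (μ.comp (fderiv ℝ (fderiv ℝ G) z v) + (ν.comp A - α • μ.comp A)) =
        projX (μ.comp (fderiv ℝ (fderiv ℝ G) z v)) +
          (projX (ν.comp A - α • μ.comp A - W k) + projX (W k)) := by
      ext x
      simp only [projX, ContinuousLinearMap.comp_apply, add_apply, sub_apply, smul_apply]
      ring
    rw [hproj] at hus
    have h3 : us - (projX (μ.comp (fderiv ℝ (fderiv ℝ G) z v)) + wx) =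
        (us - (projX (μ.comp (fderiv ℝ (fderiv ℝ G) z v)) +
          (projX (ν.comp A - α • μ.comp A - W k) + projX (W k)))) +
        (projX (ν.comp A - α • μ.comp A - W k) + (projX (W k) - wx)) := by abel
    rw [h3]
    have h4 := norm_add_le (us - (projX (μ.comp (fderiv ℝ (fderiv ℝ G) z v)) +
          (projX (ν.comp A - α • μ.comp A - W k) + projX (W k))))
        (projX (ν.comp A - α • μ.comp A - W k) + (projX (W k) - wx))
    have h5 := norm_add_le (projX (ν.comp A - α • μ.comp A - W k)) (projX (W k) - wx)
    have h6 := (norm_projX_le _).trans (hνα.trans (min_le_left _ _))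
    linarith

end IsReducedSystem

end Lower

/-! ### The reduction map: regularity and normals to `C` -/

section Reduction

variable {Y E : Type*} [NormedAddCommGroup Y] [NormedSpace ℝ Y]
  [NormedAddCommGroup E] [InnerProductSpace ℝ E]
  {C : Set Y} {y : Y} {K : ProperCone ℝ E} {V : Set Y} {h : Y → E}

namespace IsC2Reduction

theorem contDiffAt (hC : IsC2Reduction C y K V h) : ContDiffAt ℝ 2 h y :=
  hC.contDiffOn.contDiffAt (hC.isOpen_nhd.mem_nhds hC.mem_nhd)

theorem eventually_mem_iff (hC : IsC2Reduction C y K V h) : ∀ᶠ y' in 𝓝 y, y' ∈ C ↔ h y' ∈ K := by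
  filter_upwards [hC.isOpen_nhd.mem_nhds hC.mem_nhd] with y' hy' using hC.mem_iff y' hy'

/-- Metric regularity of the reduction. -/
theorem exists_regularity [FiniteDimensional ℝ Y] [FiniteDimensional ℝ E]
    (hC : IsC2Reduction C y K V h) :
    ∃ κ : ℝ, 0 ≤ κ ∧ ∀ᶠ y' in 𝓝 y, ∀ e ∈ K, ∃ c ∈ C, ‖c - y'‖ ≤ κ * ‖h y' - e‖ := by
  have : CompleteSpace Y := FiniteDimensional.complete ℝ Y
  have : CompleteSpace E := FiniteDimensional.complete ℝ E
  have hstrict : HasStrictFDerivAt h (fderiv ℝ h y) y := hC.contDiffAt.hasStrictFDerivAt (by simp)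
  obtain ⟨S, hS⟩ := (fderiv ℝ h y).exists_nonlinearRightInverse_of_surjective
    (LinearMap.range_eq_top.2 hC.surjective)
  have hN : 0 < (S.nnnorm : ℝ) := hS
  -- Half the inverse norm of the right inverse as linearization error: `h` then covers balls at
  -- rate `1 / (2 ‖S‖)`, hence the modulus `2 ‖S‖`.
  set a : ℝ≥0 := S.nnnorm⁻¹ / 2 with ha
  have ha0 : 0 < a := by positivity
  obtain ⟨s, hs, happ⟩ := hstrict.approximates_deriv_on_nhds (Or.inr ha0)
  obtain ⟨ε, hε, hball⟩ := Metric.mem_nhds_iff.1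
    (inter_mem hs (hC.isOpen_nhd.mem_nhds hC.mem_nhd))
  refine ⟨2 * S.nnnorm, by positivity, ?_⟩
  filter_upwards [Metric.ball_mem_nhds y (half_pos hε)] with y' hy' e he
  rw [Metric.mem_ball, dist_eq_norm] at hy'
  rcases lt_or_ge (2 * S.nnnorm * ‖h y' - e‖) (ε / 2) with hlt | hge
  · have hsub : Metric.closedBall y' (2 * S.nnnorm * ‖h y' - e‖) ⊆ Metric.ball y ε := by
      intro x hx
      rw [Metric.mem_closedBall] at hx
      rw [Metric.mem_ball]
      have := dist_triangle x y' y
      rw [dist_eq_norm y' y] at this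
      linarith
    have hsurj := happ.surjOn_closedBall_of_nonlinearRightInverse S (by positivity)
      (hsub.trans (hball.trans inter_subset_left))
    have hmem : e ∈ Metric.closedBall (h y')
        (((S.nnnorm : ℝ)⁻¹ - a) * (2 * S.nnnorm * ‖h y' - e‖)) := by
      rw [Metric.mem_closedBall, dist_eq_norm, norm_sub_rev, ha]
      push_cast
      refine le_of_eq ?_
      field_simp
      ring
    obtain ⟨x, hx, hxe⟩ := hsurj hmem
    refine ⟨x, (hC.mem_iff x (hball (hsub hx)).2).2 (hxe ▸ he), ?_⟩
    rwa [Metric.mem_closedBall, dist_eq_norm] at hx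
  -- If `e` is too far for the local covering, `y` itself is close enough.
  · refine ⟨y, hC.mem, ?_⟩
    rw [norm_sub_rev]
    linarith

theorem mem_normalCone_iff [FiniteDimensional ℝ Y] [FiniteDimensional ℝ E]
    (hC : IsC2Reduction C y K V h) {lam : StrongDual ℝ Y} :
    lam ∈ normalCone C y ↔ ∃ μ ∈ polarCone (K : Set E), lam = μ.comp (fderiv ℝ h y) := by
  constructor
  · intro hlam
    obtain ⟨κ, hκ, hreg⟩ := hC.exists_regularity
    obtain ⟨μ, hμ, -, -, hcomp⟩ := exists_multiplier_of_mem_normalCone K hκ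
      (hC.contDiffAt.of_le (by norm_num)) (hC.eventually_mem_iff.mono fun _ hy => hy.1) hreg hlam
    exact ⟨μ, hμ, hcomp.symm⟩
  · rintro ⟨μ, hμ, rfl⟩
    refine regularNormalCone_subset_normalCone _ _ (comp_mem_regularNormalCone K
      (hC.contDiffAt.differentiableAt (by simp)).hasFDerivAt hC.mem
      (hC.eventually_mem_iff.mono fun _ hy => hy.1) hμ ?_)
    rw [hC.map_eq_zero, map_zero]

end IsC2Reduction

theorem curvatureHessian_comp {P X : Type*} {g : P × X → Y} {z : P × X}
    (hh : ContDiffAt ℝ 2 h (g z))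
    (hsurj : Function.Surjective (fderiv ℝ h (g z))) (μ : StrongDual ℝ E) (a b : Y) :
    curvatureHessian g z h (μ.comp (fderiv ℝ h (g z))) a b =
      μ (fderiv ℝ (fderiv ℝ h) (g z) a b) := by
  have hh2 : HasFDerivAt (fderiv ℝ h) (fderiv ℝ (fderiv ℝ h) (g z)) (g z) :=
    ((hh.fderiv_right (m := 1) (by norm_num)).differentiableAt (by simp)).hasFDerivAt
  have heq : fderiv ℝ (fun y => μ (h y)) =ᶠ[𝓝 (g z)] fun y => μ.comp (fderiv ℝ h y) := by
    filter_upwards [hh.eventually (by simp)] with y hy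
    exact (μ.hasFDerivAt.comp y (hy.differentiableAt (by simp)).hasFDerivAt).fderiv
  rw [curvatureHessian, adjointInv_comp _ hsurj, heq.fderiv_eq,
    ((hasFDerivAt_const μ (g z)).clm_comp hh2).fderiv]
  simp

end Reduction

/-! ### From `g(p, x) ∈ C` to `G(p, x) ∈ K` -/

section Composition

variable {P X Y E : Type*}
  [NormedAddCommGroup P] [NormedSpace ℝ P] [NormedAddCommGroup X] [NormedSpace ℝ X]
  [NormedAddCommGroup Y] [NormedSpace ℝ Y] [NormedAddCommGroup E] [InnerProductSpace ℝ E]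
  {g : P × X → Y} {C : Set Y} {z : P × X} {K : ProperCone ℝ E} {V : Set Y} {h : Y → E}

theorem isReducedSystem_comp [FiniteDimensional ℝ Y] [FiniteDimensional ℝ E]
    (hg : ContDiffAt ℝ 2 g z) (hC : IsC2Reduction C (g z) K V h) (hRS : RobinsonStable g C z) :
    ∃ κ : ℝ, IsReducedSystem (h ∘ g) (solMap g C) K z κ := by
  obtain ⟨κ, W, hW, U, hU, hR⟩ := hRS
  obtain ⟨κ', hκ', hreg⟩ := hC.exists_regularity
  have hmem : ∀ᶠ z' in 𝓝 z, z'.2 ∈ solMap g C z'.1 ↔ (h ∘ g) z' ∈ K :=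
    hg.continuousAt.eventually hC.eventually_mem_iff
  -- The infimal distance need not be attained; the extra `1` makes the inequality strict, so an
  -- actual point exists. A zero residual is treated separately.
  refine ⟨κ * κ' + 1, hC.contDiffAt.comp z hg, hC.map_eq_zero, hmem, by positivity, ?_⟩
  filter_upwards [hmem, hg.continuousAt.eventually hreg, prod_mem_nhds hW hU]
    with z' h1 h2 h3 e he
  rcases (norm_nonneg ((h ∘ g) z' - e)).eq_or_lt with h0 | hpos
  · have hez : (h ∘ g) z' = e := sub_eq_zero.1 (norm_eq_zero.1 h0.symm)
    exact ⟨z'.2, h1.2 (hez ▸ he), by rw [sub_self, norm_zero, ← h0, mul_zero]⟩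
  · obtain ⟨c, hcC, hc⟩ := h2 e he
    have h4 : Metric.infEDist z'.2 (solMap g C z'.1) <
        ENNReal.ofReal ((κ * κ' + 1) * ‖(h ∘ g) z' - e‖) := by
      calc Metric.infEDist z'.2 (solMap g C z'.1)
          ≤ κ * Metric.infEDist (g z') C := hR z'.1 h3.1 z'.2 h3.2
        _ ≤ κ * edist (g z') c := by gcongr; exact Metric.infEDist_le_edist_of_mem hcC
        _ = ENNReal.ofReal (κ * ‖c - g z'‖) := by
            rw [edist_dist, dist_eq_norm, norm_sub_rev, ENNReal.ofReal_mul (NNReal.coe_nonneg κ),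
              ENNReal.ofReal_coe_nnreal]
        _ < ENNReal.ofReal ((κ * κ' + 1) * ‖(h ∘ g) z' - e‖) := by
            rw [ENNReal.ofReal_lt_ofReal_iff (by positivity)]
            have h5 : κ * ‖c - g z'‖ ≤ κ * (κ' * ‖h (g z') - e‖) := by gcongr
            simp only [Function.comp_apply] at hpos ⊢
            linarith
    obtain ⟨x', hx', hd⟩ := Metric.infEDist_lt_iff.1 h4
    refine ⟨x', hx', ?_⟩
    rw [edist_dist, ENNReal.ofReal_lt_ofReal_iff (by positivity), dist_eq_norm, norm_sub_rev] at hd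
    exact hd.le

theorem fderiv_fderiv_comp (hg : ContDiffAt ℝ 2 g z) (hh : ContDiffAt ℝ 2 h (g z)) (v w : P × X) :
    fderiv ℝ (fderiv ℝ (h ∘ g)) z v w =
      fderiv ℝ (fderiv ℝ h) (g z) (fderiv ℝ g z v) (fderiv ℝ g z w) +
        fderiv ℝ h (g z) (fderiv ℝ (fderiv ℝ g) z v w) := by
  have hg1 : HasFDerivAt g (fderiv ℝ g z) z := (hg.differentiableAt (by simp)).hasFDerivAt
  have hg2 : HasFDerivAt (fderiv ℝ g) (fderiv ℝ (fderiv ℝ g) z) z :=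
    ((hg.fderiv_right (m := 1) (by norm_num)).differentiableAt (by simp)).hasFDerivAt
  have hh2 : HasFDerivAt (fderiv ℝ h) (fderiv ℝ (fderiv ℝ h) (g z)) (g z) :=
    ((hh.fderiv_right (m := 1) (by norm_num)).differentiableAt (by simp)).hasFDerivAt
  have heq : fderiv ℝ (h ∘ g) =ᶠ[𝓝 z] fun z' => (fderiv ℝ h (g z')).comp (fderiv ℝ g z') := by
    filter_upwards [hg.eventually (by simp), hg.continuousAt.eventually (hh.eventually (by simp))]
      with z' h1 h2
    exact fderiv_comp z' (h2.differentiableAt (by simp)) (h1.differentiableAt (by simp))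
  have hh3 : HasFDerivAt (fun z' => fderiv ℝ h (g z'))
      ((fderiv ℝ (fderiv ℝ h) (g z)).comp (fderiv ℝ g z)) z := hh2.comp z hg1
  rw [heq.fderiv_eq, (hh3.clm_comp hg2).fderiv]
  simp [add_comm]

theorem fderiv_comp_reduction (hg : ContDiffAt ℝ 2 g z) (hh : ContDiffAt ℝ 2 h (g z)) :
    fderiv ℝ (h ∘ g) z = (fderiv ℝ h (g z)).comp (fderiv ℝ g z) :=
  fderiv_comp z (hh.differentiableAt (by simp)) (hg.differentiableAt (by simp))

/-- In the chain rule for `∇²(h ∘ g)`, the part `∇h ∇²g` is the derivative of `∇ₓg^* λ` and the part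
with `∇²h` is exactly `𝓗_λ`. -/
theorem secondOrderTerm_comp (hg : ContDiffAt ℝ 2 g z) (hh : ContDiffAt ℝ 2 h (g z))
    (hsurj : Function.Surjective (fderiv ℝ h (g z))) (μ : StrongDual ℝ E) (v : P × X) :
    secondOrderTerm g z h (μ.comp (fderiv ℝ h (g z))) v =
      projX (μ.comp (fderiv ℝ (fderiv ℝ (h ∘ g)) z v)) := by
  set lam := μ.comp (fderiv ℝ h (g z)) with hlam
  have hg2 : HasFDerivAt (fderiv ℝ g) (fderiv ℝ (fderiv ℝ g) z) z :=
    ((hg.fderiv_right (m := 1) (by norm_num)).differentiableAt (by simp)).hasFDerivAt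
  have hX : ∀ᶠ z' in 𝓝 z, derivX g z' = (fderiv ℝ g z').comp (ContinuousLinearMap.inr ℝ P X) := by
    filter_upwards [hg.eventually (by simp)] with z' h1
    exact (hasFDerivAt_partial_snd (h1.differentiableAt (by simp))).fderiv
  have heq : (fun z' => lam.comp (derivX g z')) =ᶠ[𝓝 z]
      fun z' => lam.comp ((fderiv ℝ g z').comp (ContinuousLinearMap.inr ℝ P X)) := by
    filter_upwards [hX] with z' h1
    rw [h1]
  ext x
  rw [secondOrderTerm, heq.fderiv_eq, ((hasFDerivAt_const lam z).clm_comp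
    (hg2.clm_comp (hasFDerivAt_const (ContinuousLinearMap.inr ℝ P X) z))).fderiv]
  have h1 : curvatureMap g z h lam v x =
      μ (fderiv ℝ (fderiv ℝ h) (g z) (fderiv ℝ g z v) (fderiv ℝ g z (0, x))) := by
    rw [curvatureMap, hX.self_of_nhds, hlam]
    exact curvatureHessian_comp hh hsurj μ _ _
  rw [add_apply, h1]
  simp only [projX, ContinuousLinearMap.comp_apply, ContinuousLinearMap.inr_apply,
    fderiv_fderiv_comp hg hh, map_add]
  simp [hlam, add_comm]

end Composition

/-! ### The three inclusions -/

section Inclusions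

variable {P X Y E : Type*}
  [NormedAddCommGroup P] [NormedSpace ℝ P] [NormedAddCommGroup X] [InnerProductSpace ℝ X]
  [NormedAddCommGroup Y] [NormedSpace ℝ Y] [NormedAddCommGroup E] [InnerProductSpace ℝ E]
  {g : P × X → Y} {C : Set Y} {z : P × X} {xs : StrongDual ℝ X}
  {K : ProperCone ℝ E} {V : Set Y} {h : Y → E}

/-- The objective of the directional multiplier set in reduced form. -/
theorem dirMultipliers_objective (hg : ContDiffAt ℝ 2 g z) (hC : IsC2Reduction C (g z) K V h)
    (μ : StrongDual ℝ E) (v : P × X) :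
    (μ.comp (fderiv ℝ h (g z))) (fderiv ℝ (fderiv ℝ g) z v v) +
      curvatureHessian g z h (μ.comp (fderiv ℝ h (g z))) (fderiv ℝ g z v) (fderiv ℝ g z v) =
    μ (fderiv ℝ (fderiv ℝ (h ∘ g)) z v v) := by
  rw [curvatureHessian_comp hC.contDiffAt hC.surjective, fderiv_fderiv_comp hg hC.contDiffAt,
    map_add, add_comm]
  rfl

variable [FiniteDimensional ℝ Y] [FiniteDimensional ℝ E]

theorem comp_mem_dirMultipliers_iff (hg : ContDiffAt ℝ 2 g z) (hC : IsC2Reduction C (g z) K V h)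
    {μ : StrongDual ℝ E} (hμ : μ ∈ polarCone (K : Set E)) (v : P × X) :
    μ.comp (fderiv ℝ h (g z)) ∈ dirMultipliers g C z h (μ.comp (fderiv ℝ (h ∘ g) z)) v ↔
      ∀ μ' ∈ polarCone (K : Set E), μ'.comp (fderiv ℝ (h ∘ g) z) = μ.comp (fderiv ℝ (h ∘ g) z) →
        μ' (fderiv ℝ (fderiv ℝ (h ∘ g)) z v v) ≤ μ (fderiv ℝ (fderiv ℝ (h ∘ g)) z v v) := by
  have hcomp := fderiv_comp_reduction hg hC.contDiffAt
  constructor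
  · rintro ⟨-, hmax⟩ μ' hμ' heq
    have := hmax (show μ'.comp (fderiv ℝ h (g z)) ∈ multipliers g C z _ from
      ⟨hC.mem_normalCone_iff.2 ⟨μ', hμ', rfl⟩, by
        rw [← heq, hcomp, ContinuousLinearMap.comp_assoc]⟩)
    simp only [mem_ofPred_eq, dirMultipliers_objective hg hC] at this
    exact this
  · intro hmax
    refine ⟨⟨hC.mem_normalCone_iff.2 ⟨μ, hμ, rfl⟩, by
      rw [hcomp, ContinuousLinearMap.comp_assoc]⟩, ?_⟩
    rintro lam' ⟨hlam', heq⟩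
    obtain ⟨μ', hμ', rfl⟩ := hC.mem_normalCone_iff.1 hlam'
    simp only [mem_ofPred_eq, dirMultipliers_objective hg hC]
    refine hmax μ' hμ' ?_
    rw [← heq, hcomp, ContinuousLinearMap.comp_assoc]

variable [FiniteDimensional ℝ X]

theorem modGraphicalDeriv_subset_limitSet (hg : ContDiffAt ℝ 2 g z)
    (hC : IsC2Reduction C (g z) K V h) (hRS : RobinsonStable g C z) (v : P × X) :
    modGraphicalDeriv g C z xs K h v ⊆ limitSet g C z xs h v := by
  obtain ⟨κ, hS⟩ := isReducedSystem_comp hg hC hRS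
  rintro us ⟨t, q, u, usk, ht, ht0, hq, hu, hus, hmem, M, hM⟩
  have hGd := hS.differentiableAt
  have hlin0 : (0 : E) ∈ lineality K := zero_mem _
  obtain ⟨μ, hμ, hAv, hμv, hxs, hmax, W, hW, hWx, hWv⟩ :=
    hS.lower_estimate_of_seq (w := fun k => (q k, u k)) ht ht0 (hq.prodMk_nhds hu) hus hmem
      (S := charSubspace g z K h)
      ⟨0, ⟨0, map_zero _⟩, 0, hlin0, by rw [map_zero]; exact add_zero _⟩
      (by
        rintro q' ⟨_, ⟨x, rfl⟩, l, hl, hql⟩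
        refine ⟨x, l, hl, ?_⟩
        have h1 : derivP (h ∘ g) z q' = fderiv ℝ (h ∘ g) z (q', 0) :=
          DFunLike.congr_fun (hasFDerivAt_partial_fst hGd).fderiv q'
        have h2 : derivX (h ∘ g) z x = fderiv ℝ (h ∘ g) z (0, x) :=
          DFunLike.congr_fun (hasFDerivAt_partial_snd hGd).fderiv x
        rw [← h1, ← h2]
        exact hql.symm) hM
  -- `μ ∘ ∇G` is nonpositive on the tangent cone of the graph and zero at `v`, hence normal to that
  -- cone at `v`.
  refine ⟨μ.comp (fderiv ℝ (h ∘ g) z), mem_normalCone_of_forall_le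
    (hS.subset_tangentCone_graph hAv) (fun y hy => ?_), hxs, μ.comp (fderiv ℝ h (g z)),
    (comp_mem_dirMultipliers_iff hg hC hμ v).2 hmax, _, ⟨W, fun k y hy => hW k y
      ⟨hS.tangentCone_graph_subset hy.1, hy.2⟩, hWx, hWv⟩, ?_⟩
  · rw [map_sub, ContinuousLinearMap.comp_apply, ContinuousLinearMap.comp_apply, hμv, sub_zero]
    exact hμ _ (hS.tangentCone_graph_subset hy)
  · rw [secondOrderTerm_comp hg hC.contDiffAt hC.surjective, add_sub_cancel]

theorem limitSet_subset_graphicalDeriv [FiniteDimensional ℝ P] (hg : ContDiffAt ℝ 2 g z)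
    (hC : IsC2Reduction C (g z) K V h) (hRS : RobinsonStable g C z) (v : P × X) :
    limitSet g C z xs h v ⊆ graphicalDeriv (normalMap g C) z xs v := by
  obtain ⟨κ, hS⟩ := isReducedSystem_comp hg hC hRS
  rintro _ ⟨zs, hzs, rfl, lam, hlam, wx, ⟨W, hW, hWx, hWv⟩, rfl⟩
  obtain ⟨μ, hμ, rfl⟩ := hC.mem_normalCone_iff.1 hlam.1.1
  have hzsμ : zs = μ.comp (fderiv ℝ (h ∘ g) z) := by
    rw [← hlam.1.2, fderiv_comp_reduction hg hC.contDiffAt, ContinuousLinearMap.comp_assoc]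
  subst hzsμ
  have hT : tangentCone (graph (solMap g C)) z = fderiv ℝ (h ∘ g) z ⁻¹' (K : Set E) :=
    Subset.antisymm (fun y hy => hS.tangentCone_graph_subset hy)
      fun y hy => hS.subset_tangentCone_graph hy
  rw [hT] at hzs
  have hv : fderiv ℝ (h ∘ g) z v ∈ K := hzs.1
  have hconv : Convex ℝ (fderiv ℝ (h ∘ g) z ⁻¹' (K : Set E)) :=
    K.convex.linear_preimage (fderiv ℝ (h ∘ g) z).toLinearMap
  -- The tangent cone is convex and contains `0`; testing normality there gives the reverse
  -- inequality.
  have hμv : μ (fderiv ℝ (h ∘ g) z v) = 0 := by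
    refine le_antisymm (hμ _ hv) ?_
    have := le_zero_of_mem_normalCone hconv hzs (y := 0)
      (by rw [mem_preimage, map_zero]; exact K.zero_mem)
    rw [zero_sub, map_neg, ContinuousLinearMap.comp_apply] at this
    linarith
  rw [secondOrderTerm_comp hg hC.contDiffAt hC.surjective]
  exact hS.lower_inclusion hv hμ hμv ((comp_mem_dirMultipliers_iff hg hC hμ v).1 hlam)
    (fun k y hy => hW k y ⟨hS.subset_tangentCone_graph hy.1, hy.2⟩) hWx hWv

theorem graphicalDeriv_subset_upperSet (hg : ContDiffAt ℝ 2 g z)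
    (hC : IsC2Reduction C (g z) K V h) (hRS : RobinsonStable g C z) (v : P × X) :
    graphicalDeriv (normalMap g C) z xs v ⊆ upperSet g C z xs h v := by
  obtain ⟨κ, hS⟩ := isReducedSystem_comp hg hC hRS
  intro us hus
  obtain ⟨μ, hμ, -, hμv, hxs, hpol⟩ := hS.upper_estimate hus
  have hcomp := fderiv_comp_reduction hg hC.contDiffAt
  have hh := hC.contDiffAt.differentiableAt (by simp) |>.hasFDerivAt
  have hgd := hg.differentiableAt (by simp)
  refine ⟨μ.comp (fderiv ℝ h (g z)), mem_normalCone_of_forall_le ?_ ?_, ?_, _, hpol, ?_⟩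
  · obtain ⟨t, w, ht, ht0, hw, hmem⟩ := hus
    -- Difference quotients of `g` along the feasible sequence realize `∇g(z) v` as a tangent to
    -- `C`.
    refine ⟨t, fun k => (t k)⁻¹ • (g (z + t k • (w k).1) - g z), ht, ht0,
      tendsto_difference_quotient hgd.hasFDerivAt (Eventually.of_forall ht) ht0 hw.fst_nhds,
      fun k => ?_⟩
    rw [smul_inv_smul₀ (ht k).ne', add_sub_cancel]
    exact (hmem k).1
  · rintro y ⟨t, w, ht, ht0, hw, hmem⟩
    have h1 : fderiv ℝ h (g z) y ∈ K := by
      refine K.isClosed.mem_of_tendsto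
        (tendsto_difference_quotient hh (Eventually.of_forall ht) ht0 hw) ?_
      filter_upwards [(tendsto_add_smul (z := g z) ht0 hw).eventually hC.eventually_mem_iff]
        with k hk
      rw [hC.map_eq_zero, sub_zero]
      exact K.smul_mem (hk.1 (hmem k)) (inv_nonneg.2 (ht k).le)
    have h2 : μ (fderiv ℝ h (g z) (fderiv ℝ g z v)) = 0 := by
      rw [hcomp] at hμv
      exact hμv
    rw [map_sub, ContinuousLinearMap.comp_apply, ContinuousLinearMap.comp_apply, h2, sub_zero]
    exact hμ _ h1
  · have h1 : derivX g z = (fderiv ℝ g z).comp (ContinuousLinearMap.inr ℝ P X) :=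
      (hasFDerivAt_partial_snd hgd).fderiv
    rw [← hxs, h1, hcomp]
    rfl
  · rw [secondOrderTerm_comp hg hC.contDiffAt hC.surjective, add_sub_cancel]

end Inclusions

end PCS

end

theorem mainTheorem10
    {P X Y E : Type*}
    [NormedAddCommGroup P] [InnerProductSpace ℝ P] [FiniteDimensional ℝ P]
    [NormedAddCommGroup X] [InnerProductSpace ℝ X] [FiniteDimensional ℝ X]
    [NormedAddCommGroup Y] [InnerProductSpace ℝ Y] [FiniteDimensional ℝ Y]
    [NormedAddCommGroup E] [InnerProductSpace ℝ E] [FiniteDimensional ℝ E]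
    (g : P × X → Y) (C : Set Y) (zbar : P × X) (xs : StrongDual ℝ X)
    (K : ProperCone ℝ E) (V : Set Y) (h : Y → E)
    (hg : ContDiffAt ℝ 2 g zbar)
    (hC : PCS.IsC2Reduction C (g zbar) K V h)
    (hxs : xs ∈ PCS.normalMap g C zbar)
    (hRS : PCS.RobinsonStable g C zbar)
    (v : P × X) :
    PCS.modGraphicalDeriv g C zbar xs K h v ⊆ PCS.limitSet g C zbar xs h v ∧
    PCS.limitSet g C zbar xs h v ⊆ PCS.graphicalDeriv (PCS.normalMap g C) zbar xs v ∧
    PCS.graphicalDeriv (PCS.normalMap g C) zbar xs v ⊆ PCS.upperSet g C zbar xs h v :=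
  ⟨PCS.modGraphicalDeriv_subset_limitSet hg hC hRS v,
    PCS.limitSet_subset_graphicalDeriv hg hC hRS v,
    PCS.graphicalDeriv_subset_upperSet hg hC hRS v⟩
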